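/- **Theorem.** Let $M$ be a (smooth) almost Hermitian manifold of dimension $2m$, $m\ge 2$, with Riemannian metric $g$, almost complex structure $J$ (so $J^2=-1$ and $g(JX,JY)=g(X,Y)$), Levi-Civita connection $\widetilde\nabla$ and curvature tensor $R(X,Y)Z=\widetilde\nabla_X\widetilde\nabla_YZ-\widetilde\nabla_Y\widetilde\nabla_XZ-\widetilde\nabla_{[X,Y]}Z$, $R(X,Y,Z,U)=g(R(X,Y)Z,U)$. A subspace $\alpha\subset T_pM$ is called holomorphic if $J\alpha=\alpha$ and antiholomorphic if $J\alpha\perp\alpha$; the curvature of a $2$-plane with orthonormal basis $X,Y$ is $R(X,Y,Y,X)$. Let $n$ be a fixed integer with $2\le n\le m$, and suppose that $M$ satisfies one of the following two axioms. * Axiom of antiholomorphic $n$-planes: for each point $p\in M$ and each $n$-dimensional antiholomorphic subspace $\alpha$ of $T_pM$ there is an $n$-dimensional totally geodesic submanifold $N$ of $M$ containing $p$ with $T_pN=\alpha$. * Axiom of antiholomorphic $n$-spheres: for each point $p\in M$ and each $n$-dimensional antiholomorphic subspace $\alpha$ of $T_pM$ there is an $n$-dimensional totally umbilical submanifold $N$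 of $M$ with nonzero parallel mean curvature vector, containing $p$, with $T_pN=\alpha$. Then $M$ is an $RK$-manifold, i.e. $R(X,Y,Z,U)=R(JX,JY,JZ,JU)$ for all $X,Y,Z,U\in T_pM$, $p\in M$; and there are functions $c,K:M\to\mathbb R$ such that at each point $p$ every holomorphic $2$-plane in $T_pM$ has curvature $c(p)$ and every antiholomorphic $2$-plane in $T_pM$ has curvature $K(p)$. Consequently $$R=K\,R_1+\frac{c-K}{3}\,R_2,$$ where $$R_1(X,Y,Z,U)=g(X,U)g(Y,Z)-g(X,Z)g(Y,U),$$ $$R_2(X,Y,Z,U)=g(X,JU)g(Y,JZ)-g(X,JZ)g(Y,JU)-2g(X,JY)g(Z,JU).$$ -/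

import Mathlib

open Bundle Filter Manifold Topology
open scoped ContDiff InnerProductSpace

noncomputable section

set_option linter.unusedSectionVars false

universe u

namespace AlmostHermitian

section Riemannian

variable {E : Type*} [NormedAddCommGroup E] [NormedSpace ℝ E] [FiniteDimensional ℝ E]
  [CompleteSpace E]
  {M : Type*} [TopologicalSpace M] [ChartedSpace E M] [IsManifold 𝓘(ℝ, E) ∞ M]
  [RiemannianBundle (fun x : M ↦ TangentSpace 𝓘(ℝ, E) x)]
  [IsContMDiffRiemannianBundle 𝓘(ℝ, E) ∞ E (fun x : M ↦ TangentSpace 𝓘(ℝ, E) x)]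

/-- The right hand side of the Koszul formula, at the point `p`, for vector fields `X`, `Y`, `Z`:
`X⟨Y,Z⟩ + Y⟨X,Z⟩ - Z⟨X,Y⟩ + ⟨[X,Y],Z⟩ - ⟨[X,Z],Y⟩ - ⟨[Y,Z],X⟩`. -/
def koszul (X Y Z : Π x : M, TangentSpace 𝓘(ℝ, E) x) (p : M) : ℝ :=
  mvfderiv 𝓘(ℝ, E) (fun x ↦ ⟪Y x, Z x⟫_ℝ) p (X p)
    + mvfderiv 𝓘(ℝ, E) (fun x ↦ ⟪X x, Z x⟫_ℝ) p (Y p)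
    - mvfderiv 𝓘(ℝ, E) (fun x ↦ ⟪X x, Y x⟫_ℝ) p (Z p)
    + ⟪VectorField.mlieBracket 𝓘(ℝ, E) X Y p, Z p⟫_ℝ
    - ⟪VectorField.mlieBracket 𝓘(ℝ, E) X Z p, Y p⟫_ℝ
    - ⟪VectorField.mlieBracket 𝓘(ℝ, E) Y Z p, X p⟫_ℝ

variable {p : M}

instance isContMDiffRiemannianBundle_one :
    IsContMDiffRiemannianBundle 𝓘(ℝ, E) 1 E (fun x : M ↦ TangentSpace 𝓘(ℝ, E) x) :=
  IsContMDiffRiemannianBundle.of_le (n := ∞) (by norm_cast)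

instance finiteDimensional_tangentSpace (p : M) : FiniteDimensional ℝ (TangentSpace 𝓘(ℝ, E) p) :=
  inferInstanceAs (FiniteDimensional ℝ E)

instance completeSpace_tangentSpace (p : M) : CompleteSpace (TangentSpace 𝓘(ℝ, E) p) :=
  FiniteDimensional.complete ℝ _


theorem mdifferentiableAt_inner {X Y : Π x : M, TangentSpace 𝓘(ℝ, E) x}
    (hX : MDiffAt (T% X) p) (hY : MDiffAt (T% Y) p) :
    MDiffAt (fun x ↦ ⟪X x, Y x⟫_ℝ) p :=
  MDifferentiableAt.inner_bundle (IB := 𝓘(ℝ, E)) (F := E)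
    (E := fun x : M ↦ TangentSpace 𝓘(ℝ, E) x) (b := fun x ↦ x) hX hY

theorem koszul_tensorialAt_left {Y Z : Π x : M, TangentSpace 𝓘(ℝ, E) x}
    (hY : MDiffAt (T% Y) p) (hZ : MDiffAt (T% Z) p) :
    TensorialAt 𝓘(ℝ, E) E (koszul · Y Z p) p where
  smul {f X} hf hX := by
    have h1 : (fun x ↦ ⟪(f • X) x, Z x⟫_ℝ) = fun x ↦ f x * ⟪X x, Z x⟫_ℝ := by
      ext x; simp [inner_smul_left]
    have h2 : (fun x ↦ ⟪(f • X) x, Y x⟫_ℝ) = fun x ↦ f x * ⟪X x, Y x⟫_ℝ := by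
      ext x; simp [inner_smul_left]
    simp only [koszul, h1, h2, mvfderiv_fun_mul hf (mdifferentiableAt_inner hX hZ),
      mvfderiv_fun_mul hf (mdifferentiableAt_inner hX hY), VectorField.mlieBracket_smul_left hf hX]
    simp [inner_add_left, inner_smul_left, inner_smul_right]
    ring
  add {X X'} hX hX' := by
    have h1 : (fun x ↦ ⟪(X + X') x, Z x⟫_ℝ) = fun x ↦ ⟪X x, Z x⟫_ℝ + ⟪X' x, Z x⟫_ℝ := by
      ext x; simp [inner_add_left]
    have h2 : (fun x ↦ ⟪(X + X') x, Y x⟫_ℝ) = fun x ↦ ⟪X x, Y x⟫_ℝ + ⟪X' x, Y x⟫_ℝ := by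
      ext x; simp [inner_add_left]
    simp only [koszul, h1, h2,
      mvfderiv_fun_add (mdifferentiableAt_inner hX hZ) (mdifferentiableAt_inner hX' hZ),
      mvfderiv_fun_add (mdifferentiableAt_inner hX hY) (mdifferentiableAt_inner hX' hY),
      VectorField.mlieBracket_add_left hX hX']
    simp [inner_add_left, inner_add_right]
    ring

theorem koszul_tensorialAt_right {X Y : Π x : M, TangentSpace 𝓘(ℝ, E) x}
    (hX : MDiffAt (T% X) p) (hY : MDiffAt (T% Y) p) :
    TensorialAt 𝓘(ℝ, E) E (koszul X Y · p) p where
  smul {f Z} hf hZ := by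
    have h1 : (fun x ↦ ⟪X x, (f • Z) x⟫_ℝ) = fun x ↦ f x * ⟪X x, Z x⟫_ℝ := by
      ext x; simp [inner_smul_right]
    have h2 : (fun x ↦ ⟪Y x, (f • Z) x⟫_ℝ) = fun x ↦ f x * ⟪Y x, Z x⟫_ℝ := by
      ext x; simp [inner_smul_right]
    simp only [koszul, h1, h2, mvfderiv_fun_mul hf (mdifferentiableAt_inner hX hZ),
      mvfderiv_fun_mul hf (mdifferentiableAt_inner hY hZ),
      VectorField.mlieBracket_smul_right hf hZ]
    simp [inner_add_left, inner_smul_left, inner_smul_right, real_inner_comm]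
    ring
  add {Z Z'} hZ hZ' := by
    have h1 : (fun x ↦ ⟪X x, (Z + Z') x⟫_ℝ) = fun x ↦ ⟪X x, Z x⟫_ℝ + ⟪X x, Z' x⟫_ℝ := by
      ext x; simp [inner_add_right]
    have h2 : (fun x ↦ ⟪Y x, (Z + Z') x⟫_ℝ) = fun x ↦ ⟪Y x, Z x⟫_ℝ + ⟪Y x, Z' x⟫_ℝ := by
      ext x; simp [inner_add_right]
    simp only [koszul, h1, h2,
      mvfderiv_fun_add (mdifferentiableAt_inner hX hZ) (mdifferentiableAt_inner hX hZ'),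
      mvfderiv_fun_add (mdifferentiableAt_inner hY hZ) (mdifferentiableAt_inner hY hZ'),
      VectorField.mlieBracket_add_right hZ hZ']
    simp [inner_add_left, inner_add_right]
    ring

theorem koszul_add_middle {X Y Y' Z : Π x : M, TangentSpace 𝓘(ℝ, E) x}
    (hX : MDiffAt (T% X) p) (hY : MDiffAt (T% Y) p) (hY' : MDiffAt (T% Y') p)
    (hZ : MDiffAt (T% Z) p) :
    koszul X (Y + Y') Z p = koszul X Y Z p + koszul X Y' Z p := by
  have h1 : (fun x ↦ ⟪X x, (Y + Y') x⟫_ℝ) = fun x ↦ ⟪X x, Y x⟫_ℝ + ⟪X x, Y' x⟫_ℝ := by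
    ext x; simp [inner_add_right]
  have h2 : (fun x ↦ ⟪(Y + Y') x, Z x⟫_ℝ) = fun x ↦ ⟪Y x, Z x⟫_ℝ + ⟪Y' x, Z x⟫_ℝ := by
    ext x; simp [inner_add_left]
  simp only [koszul, h1, h2,
    mvfderiv_fun_add (mdifferentiableAt_inner hX hY) (mdifferentiableAt_inner hX hY'),
    mvfderiv_fun_add (mdifferentiableAt_inner hY hZ) (mdifferentiableAt_inner hY' hZ),
    VectorField.mlieBracket_add_right hY hY', VectorField.mlieBracket_add_left hY hY']
  simp [inner_add_left, inner_add_right]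
  ring

theorem koszul_smul_middle {X Y Z : Π x : M, TangentSpace 𝓘(ℝ, E) x} {f : M → ℝ}
    (hX : MDiffAt (T% X) p) (hY : MDiffAt (T% Y) p) (hZ : MDiffAt (T% Z) p)
    (hf : MDiffAt f p) :
    koszul X (f • Y) Z p
      = f p * koszul X Y Z p + 2 * (mvfderiv 𝓘(ℝ, E) f p (X p) * ⟪Y p, Z p⟫_ℝ) := by
  have h1 : (fun x ↦ ⟪X x, (f • Y) x⟫_ℝ) = fun x ↦ f x * ⟪X x, Y x⟫_ℝ := by
    ext x; simp [inner_smul_right]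
  have h2 : (fun x ↦ ⟪(f • Y) x, Z x⟫_ℝ) = fun x ↦ f x * ⟪Y x, Z x⟫_ℝ := by
    ext x; simp [inner_smul_left]
  simp only [koszul, h1, h2, mvfderiv_fun_mul hf (mdifferentiableAt_inner hX hY),
    mvfderiv_fun_mul hf (mdifferentiableAt_inner hY hZ),
    VectorField.mlieBracket_smul_right hf hY, VectorField.mlieBracket_smul_left hf hY]
  simp [inner_add_left, inner_smul_left, inner_smul_right, real_inner_comm]
  ring

/-- The Koszul expression as a bilinear form in the values of `X` and `Z` at `p`. -/
def koszulForm {Y : Π x : M, TangentSpace 𝓘(ℝ, E) x} (hY : MDiffAt (T% Y) p) :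
    TangentSpace 𝓘(ℝ, E) p →L[ℝ] TangentSpace 𝓘(ℝ, E) p →L[ℝ] ℝ :=
  TensorialAt.mkHom₂ (fun X Z ↦ koszul X Y Z p) p
    (fun _ hZ ↦ koszul_tensorialAt_left hY hZ) (fun _ hX ↦ koszul_tensorialAt_right hX hY)

theorem koszulForm_apply {X Y Z : Π x : M, TangentSpace 𝓘(ℝ, E) x}
    (hX : MDiffAt (T% X) p) (hY : MDiffAt (T% Y) p) (hZ : MDiffAt (T% Z) p) :
    koszulForm hY (X p) (Z p) = koszul X Y Z p :=
  TensorialAt.mkHom₂_apply (fun _ hZ ↦ koszul_tensorialAt_left hY hZ)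
    (fun _ hX ↦ koszul_tensorialAt_right hX hY) hX hZ

open Classical in
/-- The covariant derivative of the field `Y` at `p`: the linear map `x ↦ ∇_x Y` determined by
`2⟨∇_x Y, z⟩ = koszul`; zero if `Y` is not differentiable at `p`. -/
def leviCivitaFun (Y : Π x : M, TangentSpace 𝓘(ℝ, E) x) (p : M) :
    TangentSpace 𝓘(ℝ, E) p →L[ℝ] TangentSpace 𝓘(ℝ, E) p :=
  if hY : MDiffAt (T% Y) p then
    InnerProductSpace.continuousLinearMapOfBilin (𝕜 := ℝ) ((1 / 2 : ℝ) • koszulForm hY)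
  else 0

/-- The Koszul formula. -/
theorem two_mul_inner_leviCivitaFun {X Y Z : Π x : M, TangentSpace 𝓘(ℝ, E) x}
    (hX : MDiffAt (T% X) p) (hY : MDiffAt (T% Y) p) (hZ : MDiffAt (T% Z) p) :
    2 * ⟪leviCivitaFun Y p (X p), Z p⟫_ℝ = koszul X Y Z p := by
  rw [leviCivitaFun, dif_pos hY, InnerProductSpace.continuousLinearMapOfBilin_apply,
    ← koszulForm_apply hX hY hZ]
  simp

theorem leviCivitaFun_ext {v w : TangentSpace 𝓘(ℝ, E) p}
    (h : ∀ Z : Π x : M, TangentSpace 𝓘(ℝ, E) x, MDiffAt (T% Z) p →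
      2 * ⟪v, Z p⟫_ℝ = 2 * ⟪w, Z p⟫_ℝ) : v = w := by
  refine ext_inner_right ℝ fun z ↦ ?_
  have := h (FiberBundle.extend E z) (FiberBundle.mdifferentiableAt_extend ..)
  simpa using this

/-- The Levi-Civita connection of the Riemannian manifold `M`. -/
def leviCivita : CovariantDerivative 𝓘(ℝ, E) E (fun x : M ↦ TangentSpace 𝓘(ℝ, E) x) where
  toFun := leviCivitaFun
  isCovariantDerivativeOnUniv :=
    { add := by
        intro Y Y' p hY hY' _
        ext u
        refine leviCivitaFun_ext fun Z hZ ↦ ?_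
        have hX := FiberBundle.mdifferentiableAt_extend 𝓘(ℝ, E) E u
        have hs := mdifferentiableAt_add_section hY hY'
        have e := two_mul_inner_leviCivitaFun hX hs hZ
        have e1 := two_mul_inner_leviCivitaFun hX hY hZ
        have e2 := two_mul_inner_leviCivitaFun hX hY' hZ
        have e3 := koszul_add_middle hX hY hY' hZ
        simp only [FiberBundle.extend_apply_self] at e e1 e2
        simp only [add_apply, inner_add_left]
        linarith
      leibniz := by
        intro Y f p hY hf _
        ext u
        refine leviCivitaFun_ext fun Z hZ ↦ ?_
        have hX := FiberBundle.mdifferentiableAt_extend 𝓘(ℝ, E) E u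
        have hs := hf.smul_section hY
        have e := two_mul_inner_leviCivitaFun hX hs hZ
        have e1 := two_mul_inner_leviCivitaFun hX hY hZ
        have e3 := koszul_smul_middle hX hY hZ hf
        simp only [FiberBundle.extend_apply_self] at e e1 e3
        rw [e3, ← e1] at e
        simp only [add_apply, smul_apply, ContinuousLinearMap.smulRight_apply, inner_add_left,
          inner_smul_left, conj_trivial]
        linarith }

theorem leviCivita_torsion : (leviCivita (M := M) (E := E)).torsion = 0 := by
  rw [CovariantDerivative.torsion_eq_zero_iff]
  intro X Y p hX hY
  refine leviCivitaFun_ext fun Z hZ ↦ ?_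
  have e1 := two_mul_inner_leviCivitaFun hX hY hZ
  have e2 := two_mul_inner_leviCivitaFun hY hX hZ
  change 2 * ⟪leviCivitaFun Y p (X p) - leviCivitaFun X p (Y p), Z p⟫_ℝ = _
  rw [inner_sub_left, mul_sub, e1, e2, koszul, koszul,
    VectorField.mlieBracket_swap_apply (V := Y) (W := X)]
  simp only [real_inner_comm, inner_neg_left]
  ring

theorem leviCivita_metric {X Y Z : Π x : M, TangentSpace 𝓘(ℝ, E) x}
    (hX : MDiffAt (T% X) p) (hY : MDiffAt (T% Y) p) (hZ : MDiffAt (T% Z) p) :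
    mvfderiv 𝓘(ℝ, E) (fun x ↦ ⟪Y x, Z x⟫_ℝ) p (X p)
      = ⟪leviCivita Y p (X p), Z p⟫_ℝ + ⟪Y p, leviCivita Z p (X p)⟫_ℝ := by
  have e1 := two_mul_inner_leviCivitaFun hX hY hZ
  have e2 := two_mul_inner_leviCivitaFun hX hZ hY
  change _ = ⟪leviCivitaFun Y p (X p), Z p⟫_ℝ + ⟪Y p, leviCivitaFun Z p (X p)⟫_ℝ
  rw [real_inner_comm (leviCivitaFun Z p (X p))]
  rw [koszul, VectorField.mlieBracket_swap_apply (V := Y) (W := Z)] at *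
  simp only [real_inner_comm, inner_neg_left] at *
  linarith

/-- `R(X,Y)Z = ∇_X ∇_Y Z - ∇_Y ∇_X Z - ∇_[X,Y] Z` at `p`, for vector fields `X`, `Y`, `Z`. -/
def curvatureOfFields (X Y Z : Π x : M, TangentSpace 𝓘(ℝ, E) x) (p : M) :
    TangentSpace 𝓘(ℝ, E) p :=
  leviCivita (fun q ↦ leviCivita Z q (Y q)) p (X p)
    - leviCivita (fun q ↦ leviCivita Z q (X q)) p (Y p)
    - leviCivita Z p (VectorField.mlieBracket 𝓘(ℝ, E) X Y p)

/-- The curvature tensor `R(x,y)z` on tangent vectors at `p`. Since the curvature is tensorial, the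
vectors may be extended to any vector fields that are smooth near `p`; the extensions used here
have constant coordinates in the preferred chart at `p`. -/
def curvature (p : M) (x y z : TangentSpace 𝓘(ℝ, E) p) : TangentSpace 𝓘(ℝ, E) p :=
  curvatureOfFields (FiberBundle.extend E x) (FiberBundle.extend E y) (FiberBundle.extend E z) p

/-- `R(x,y,z,u) = g(R(x,y)z, u)`. -/
def curvature₄ (p : M) (x y z u : TangentSpace 𝓘(ℝ, E) p) : ℝ :=
  ⟪curvature p x y z, u⟫_ℝ

/-- The tensor `R₁(x,y,z,u) = g(x,u)g(y,z) - g(x,z)g(y,u)`. -/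
def R₁ (p : M) (x y z u : TangentSpace 𝓘(ℝ, E) p) : ℝ :=
  ⟪x, u⟫_ℝ * ⟪y, z⟫_ℝ - ⟪x, z⟫_ℝ * ⟪y, u⟫_ℝ

/-! ### Immersed submanifolds -/

section Submanifold

variable (n : ℕ) {N : Type*} [TopologicalSpace N] [ChartedSpace (EuclideanSpace ℝ (Fin n)) N]

/-- The tangent space of the submanifold `f : N → M` at the point `a`, as a subspace of the tangent
space of `M` at `f a`. -/
def tangentSubspace (f : N → M) (a : N) : Submodule ℝ (TangentSpace 𝓘(ℝ, E) (f a)) :=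
  LinearMap.range (mfderiv (𝓡 n) 𝓘(ℝ, E) f a).toLinearMap

/-- The component of `v` that is normal to the submanifold `f : N → M` at `a`. -/
def normalPart (f : N → M) (a : N) (v : TangentSpace 𝓘(ℝ, E) (f a)) :
    TangentSpace 𝓘(ℝ, E) (f a) :=
  (tangentSubspace n f a)ᗮ.starProjection v

/-- `X` is, near `a`, a smooth extension to `M` of a vector field on the submanifold `f : N → M`. -/
def IsTangentNear (f : N → M) (a : N) (X : Π x : M, TangentSpace 𝓘(ℝ, E) x) : Prop :=
  ContMDiffAt 𝓘(ℝ, E) 𝓘(ℝ, E).tangent ∞ (T% X) (f a) ∧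
    ∀ᶠ b in 𝓝 a, X (f b) ∈ tangentSubspace n f b

/-- The second fundamental form at `a` of the submanifold `f : N → M`, on fields that are tangent to
`N` near `a`: the difference of `∇̃_X Y` and its tangential part. -/
def secondFundamentalForm (f : N → M) (a : N) (X Y : Π x : M, TangentSpace 𝓘(ℝ, E) x) :
    TangentSpace 𝓘(ℝ, E) (f a) :=
  normalPart n f a (leviCivita Y (f a) (X (f a)))

/-- The submanifold `f : N → M` is totally geodesic. -/
def IsTotallyGeodesic (f : N → M) : Prop :=
  ∀ (a : N) (X Y : Π x : M, TangentSpace 𝓘(ℝ, E) x), IsTangentNear n f a X → IsTangentNear n f a Y →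
    secondFundamentalForm n f a X Y = 0

/-- `H` is a smooth normal vector field along the submanifold `f : N → M`. -/
def IsNormalField (f : N → M) (H : Π a : N, TangentSpace 𝓘(ℝ, E) (f a)) : Prop :=
  ContMDiff (𝓡 n) 𝓘(ℝ, E).tangent ∞ (fun a ↦ (⟨f a, H a⟩ : TangentBundle 𝓘(ℝ, E) M)) ∧
    ∀ a, H a ∈ (tangentSubspace n f a)ᗮ

/-- The submanifold `f : N → M` is totally umbilical with mean curvature vector field `H`: the
second fundamental form is `⟨X, Y⟩ H` (so that `H` is its trace divided by the dimension). -/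
def IsTotallyUmbilical (f : N → M) (H : Π a : N, TangentSpace 𝓘(ℝ, E) (f a)) : Prop :=
  IsNormalField n f H ∧
    ∀ (a : N) (X Y : Π x : M, TangentSpace 𝓘(ℝ, E) x), IsTangentNear n f a X → IsTangentNear n f a Y →
      secondFundamentalForm n f a X Y = ⟪X (f a), Y (f a)⟫_ℝ • H a

/-- The normal field `H` is parallel with respect to the normal connection: the normal part of
`∇̃_v ξ` vanishes for every tangent vector `v` of `N` and every local extension `ξ` of `H`. -/
def IsParallelNormal (f : N → M) (H : Π a : N, TangentSpace 𝓘(ℝ, E) (f a)) : Prop :=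
  ∀ (a : N) (ξ : Π x : M, TangentSpace 𝓘(ℝ, E) x),
    ContMDiffAt 𝓘(ℝ, E) 𝓘(ℝ, E).tangent ∞ (T% ξ) (f a) → (∀ᶠ b in 𝓝 a, ξ (f b) = H b) →
      ∀ v ∈ tangentSubspace n f a, normalPart n f a (leviCivita ξ (f a) v) = 0

end Submanifold

end Riemannian

/-! ### Almost Hermitian manifolds -/

/-- An almost Hermitian structure on the Riemannian manifold `M`: a smooth field `J` of orthogonal
endomorphisms of the tangent spaces with `J² = -1`. -/
structure AlmostHermitianStructure (E : Type*) [NormedAddCommGroup E] [NormedSpace ℝ E]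
    (M : Type*) [TopologicalSpace M] [ChartedSpace E M] [IsManifold 𝓘(ℝ, E) ∞ M]
    [RiemannianBundle (fun x : M ↦ TangentSpace 𝓘(ℝ, E) x)] where
  J : Π x : M, TangentSpace 𝓘(ℝ, E) x →L[ℝ] TangentSpace 𝓘(ℝ, E) x
  smooth : ContMDiff 𝓘(ℝ, E) (𝓘(ℝ, E).prod 𝓘(ℝ, E →L[ℝ] E)) ∞
    (fun x ↦ TotalSpace.mk' (E →L[ℝ] E)
      (E := fun x : M ↦ TangentSpace 𝓘(ℝ, E) x →L[ℝ] TangentSpace 𝓘(ℝ, E) x) x (J x))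
  J_J : ∀ (x : M) (v : TangentSpace 𝓘(ℝ, E) x), J x (J x v) = -v
  inner_J_J : ∀ (x : M) (v w : TangentSpace 𝓘(ℝ, E) x), ⟪J x v, J x w⟫_ℝ = ⟪v, w⟫_ℝ

namespace AlmostHermitianStructure

variable {E : Type*} [NormedAddCommGroup E] [NormedSpace ℝ E] [FiniteDimensional ℝ E]
  [CompleteSpace E]
  {M : Type u} [TopologicalSpace M] [ChartedSpace E M] [IsManifold 𝓘(ℝ, E) ∞ M]
  [RiemannianBundle (fun x : M ↦ TangentSpace 𝓘(ℝ, E) x)]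
  [IsContMDiffRiemannianBundle 𝓘(ℝ, E) ∞ E (fun x : M ↦ TangentSpace 𝓘(ℝ, E) x)]
  (S : AlmostHermitianStructure E M)

/-- The subspace `α` is holomorphic: `Jα = α`. -/
def IsHolomorphic {p : M} (α : Submodule ℝ (TangentSpace 𝓘(ℝ, E) p)) : Prop :=
  α.map (S.J p).toLinearMap = α

/-- The subspace `α` is antiholomorphic (totally real): `Jα ⟂ α`. -/
def IsAntiholomorphic {p : M} (α : Submodule ℝ (TangentSpace 𝓘(ℝ, E) p)) : Prop :=
  ∀ x ∈ α, ∀ y ∈ α, ⟪S.J p x, y⟫_ℝ = 0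

/-- The curvature of every holomorphic plane at `p`, with orthonormal basis `x`, `y`, is `c p`. -/
def HasHolomorphicCurvature (c : M → ℝ) : Prop :=
  ∀ (p : M) (x y : TangentSpace 𝓘(ℝ, E) p), Orthonormal ℝ ![x, y] →
    S.IsHolomorphic (Submodule.span ℝ {x, y}) → curvature₄ p x y y x = c p

/-- The curvature of every antiholomorphic plane at `p`, with orthonormal basis `x`, `y`,
is `K p`. -/
def HasAntiholomorphicCurvature (K : M → ℝ) : Prop :=
  ∀ (p : M) (x y : TangentSpace 𝓘(ℝ, E) p), Orthonormal ℝ ![x, y] →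
    S.IsAntiholomorphic (Submodule.span ℝ {x, y}) → curvature₄ p x y y x = K p

/-- `M` is an RK-manifold: its curvature tensor is invariant under `J`. -/
def IsRK : Prop :=
  ∀ (p : M) (x y z u : TangentSpace 𝓘(ℝ, E) p),
    curvature₄ p x y z u = curvature₄ p (S.J p x) (S.J p y) (S.J p z) (S.J p u)

/-- The tensor `R₂(x,y,z,u) = g(x,Ju)g(y,Jz) - g(x,Jz)g(y,Ju) - 2g(x,Jy)g(z,Ju)`. -/
def R₂ (p : M) (x y z u : TangentSpace 𝓘(ℝ, E) p) : ℝ :=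
  ⟪x, S.J p u⟫_ℝ * ⟪y, S.J p z⟫_ℝ - ⟪x, S.J p z⟫_ℝ * ⟪y, S.J p u⟫_ℝ
    - 2 * ⟪x, S.J p y⟫_ℝ * ⟪z, S.J p u⟫_ℝ

/-- The axiom of antiholomorphic `n`-planes: for every point `p` and every antiholomorphic
`n`-dimensional subspace `α` of the tangent space at `p`, there is a totally geodesic (immersed)
`n`-dimensional submanifold through `p` with tangent space `α`. -/
def AxiomOfAntiholomorphicPlanes (n : ℕ) : Prop :=
  ∀ (p : M) (α : Submodule ℝ (TangentSpace 𝓘(ℝ, E) p)), Module.finrank ℝ α = n →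
    S.IsAntiholomorphic α →
    ∃ (N : Type u) (_ : TopologicalSpace N) (_ : ChartedSpace (EuclideanSpace ℝ (Fin n)) N)
      (_ : IsManifold (𝓡 n) ∞ N) (f : N → M) (a : N) (h : f a = p),
      IsImmersion (𝓡 n) 𝓘(ℝ, E) ∞ f ∧ (h ▸ tangentSubspace n f a) = α ∧
      IsTotallyGeodesic (E := E) n f

/-- The axiom of antiholomorphic `n`-spheres: for every point `p` and every antiholomorphic
`n`-dimensional subspace `α` of the tangent space at `p`, there is a totally umbilical (immersed)
`n`-dimensional submanifold with nonzero parallel mean curvature vector through `p` with tangent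
space `α`. -/
def AxiomOfAntiholomorphicSpheres (n : ℕ) : Prop :=
  ∀ (p : M) (α : Submodule ℝ (TangentSpace 𝓘(ℝ, E) p)), Module.finrank ℝ α = n →
    S.IsAntiholomorphic α →
    ∃ (N : Type u) (_ : TopologicalSpace N) (_ : ChartedSpace (EuclideanSpace ℝ (Fin n)) N)
      (_ : IsManifold (𝓡 n) ∞ N) (f : N → M) (a : N) (h : f a = p),
      IsImmersion (𝓡 n) 𝓘(ℝ, E) ∞ f ∧ (h ▸ tangentSubspace n f a) = α ∧
      ∃ H : Π b : N, TangentSpace 𝓘(ℝ, E) (f b),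
        IsTotallyUmbilical n f H ∧ (∀ b, H b ≠ 0) ∧ IsParallelNormal n f H

end AlmostHermitianStructure

end AlmostHermitian

end

/-!
Both axioms provide, through every antiholomorphic `n`-dimensional subspace `α`, a submanifold whose
second fundamental form is `⟪X, Y⟫ ξ` with `ξ` normal and parallel in the normal bundle (`ξ = 0` in
the totally geodesic case). For such a submanifold the Codazzi equation says that the normal part of
`R(X, Y)Z` vanishes on tangent fields, so that `α` is invariant under the curvature of `M`
(`curvature_mem_of_axiom`). The computation is done with coordinate fields of a chart of `M` in
which the immersion is a linear inclusion; that its result is a statement about the curvature tensor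
rests on the tensoriality of the curvature (`curvatureOfFields_eq_curvature`), and `ξ` is obtained
by extending the mean curvature vector from the slice (`IsSliceChart.exists_extension`).

The rest is linear algebra in one tangent space. Let `x` and `y` be orthogonal for the Hermitian
form. If `z` is orthogonal to both, they lie in an antiholomorphic `n`-dimensional subspace that is
orthogonal to `z`, hence `R(x, y, y, z) = 0` (`isAntiholomorphicFlat_of_invariant`). Polarizing this
condition gives in turn
* the equality of all antiholomorphic sectional curvatures, by rotating the vectors of an
  antiholomorphic plane (`IsCurvatureLike.antiholomorphic_const`);
* the equality of all holomorphic sectional curvatures, by evaluating `R(x, Jx, Jx, y) = 0` on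
  the orthogonal pairs in the plane of `x` and `y` (`IsCurvatureLike.exists_holomorphic_const`);
* all sectional curvatures, since an arbitrary `y` is a combination of `x`, `Jx` and a vector
  Hermitian orthogonal to `x`.
A curvature tensor is determined by its sectional curvatures, so `R` is the asserted combination of
`R₁` and `R₂` (`IsCurvatureLike.exists_eq_model`), and the `J`-invariance of `R` is that of `R₁` and
`R₂`.
-/

noncomputable section

set_option linter.unusedSectionVars false

universe v

namespace AlmostHermitian

/-! ### Smooth vector fields -/

section

variable {E : Type*} [NormedAddCommGroup E] [NormedSpace ℝ E] {M : Type*} [TopologicalSpace M]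
  [ChartedSpace E M] [IsManifold 𝓘(ℝ, E) ∞ M]

theorem isManifold_minSmoothness_two : IsManifold 𝓘(ℝ, E) (minSmoothness ℝ 2) M :=
  IsManifold.of_le (n := ∞) (by simp; norm_cast)

theorem isManifold_minSmoothness_three : IsManifold 𝓘(ℝ, E) (minSmoothness ℝ 3) M :=
  IsManifold.of_le (n := ∞) (by simp; norm_cast)

end

-- The lemmas on Lie brackets of vector fields search for these instances.
attribute [local instance] isManifold_minSmoothness_two isManifold_minSmoothness_three

section SmoothFields

variable {E : Type*} [NormedAddCommGroup E] [NormedSpace ℝ E] [FiniteDimensional ℝ E]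
  [CompleteSpace E]
  {M : Type*} [TopologicalSpace M] [ChartedSpace E M] [IsManifold 𝓘(ℝ, E) ∞ M]
  [RiemannianBundle (fun x : M ↦ TangentSpace 𝓘(ℝ, E) x)]
  [IsContMDiffRiemannianBundle 𝓘(ℝ, E) ∞ E (fun x : M ↦ TangentSpace 𝓘(ℝ, E) x)]
  {p : M}

/-- The vector field `X` is smooth at `p`. -/
def SmoothAt (X : Π x : M, TangentSpace 𝓘(ℝ, E) x) (p : M) : Prop :=
  ContMDiffAt 𝓘(ℝ, E) 𝓘(ℝ, E).tangent ∞ (T% X) p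

variable {X Y Z W : Π x : M, TangentSpace 𝓘(ℝ, E) x} {f : M → ℝ}

theorem SmoothAt.mdiff (hX : SmoothAt X p) : MDiffAt (T% X) p :=
  ContMDiffAt.mdifferentiableAt hX (by simp)

theorem SmoothAt.eventually_mdiff (hX : SmoothAt X p) : ∀ᶠ q in 𝓝 p, MDiffAt (T% X) q :=
  ((contMDiffAt_iff_contMDiffAt_nhds (by simp)).1
    (ContMDiffAt.of_le hX (m := 1) (by norm_cast))).mono
      fun _ h ↦ ContMDiffAt.mdifferentiableAt h one_ne_zero

theorem eventually_mdifferentiableAt (hf : CMDiffAt ∞ f p) : ∀ᶠ q in 𝓝 p, MDiffAt f q :=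
  ((contMDiffAt_iff_contMDiffAt_nhds (by simp)).1
    (ContMDiffAt.of_le hf (m := 1) (by norm_cast))).mono
      fun _ h ↦ h.mdifferentiableAt one_ne_zero

theorem smoothAt_extend (v : TangentSpace 𝓘(ℝ, E) p) : SmoothAt (FiberBundle.extend E v) p :=
  FiberBundle.contMDiffAt_extend 𝓘(ℝ, E) E v

theorem SmoothAt.sub (hX : SmoothAt X p) (hY : SmoothAt Y p) : SmoothAt (X - Y) p :=
  ContMDiffAt.sub_section hX hY

theorem SmoothAt.smul (hf : CMDiffAt ∞ f p) (hX : SmoothAt X p) : SmoothAt (f • X) p :=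
  ContMDiffAt.smul_section hf hX

theorem SmoothAt.inner (hX : SmoothAt X p) (hY : SmoothAt Y p) :
    CMDiffAt ∞ (fun q ↦ ⟪X q, Y q⟫_ℝ) p :=
  ContMDiffAt.inner_bundle (IB := 𝓘(ℝ, E)) (F := E)
    (E := fun x : M ↦ TangentSpace 𝓘(ℝ, E) x) (b := fun x ↦ x) hX hY

theorem SmoothAt.mlieBracket (hX : SmoothAt X p) (hY : SmoothAt Y p) :
    SmoothAt (VectorField.mlieBracket 𝓘(ℝ, E) X Y) p :=
  haveI : IsManifold 𝓘(ℝ, E) (((⊤ : ℕ∞) : ℕ∞ω) + 1) M :=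
    IsManifold.of_le (n := ∞) (by norm_cast)
  ContMDiffAt.mlieBracket_vectorField (n := ⊤) (m := ⊤) hX hY (by simp)

theorem SmoothAt.mvfderiv (hf : CMDiffAt ∞ f p) (hX : SmoothAt X p) :
    CMDiffAt ∞ (fun q ↦ mvfderiv 𝓘(ℝ, E) f q (X q)) p := by
  have h1 := hf.mfderiv_const (m := ∞) (by simp)
  have h2 := ContMDiffAt.clm_apply_of_inCoordinates (IM := 𝓘(ℝ, E)) (IB₁ := 𝓘(ℝ, E))
    (IB₂ := 𝓘(ℝ, ℝ)) (F₁ := E) (F₂ := ℝ) (b₁ := fun q : M ↦ q) (b₂ := f)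
    (E₁ := TangentSpace 𝓘(ℝ, E)) (E₂ := TangentSpace 𝓘(ℝ, ℝ))
    (ϕ := fun q ↦ mfderiv 𝓘(ℝ, E) 𝓘(ℝ, ℝ) f q) (v := X) h1 hX hf
  rw [contMDiffAt_totalSpace] at h2
  exact h2.2.congr_of_eventuallyEq (Eventually.of_forall fun q ↦ by
    simp [_root_.mvfderiv]
    rfl)

theorem SmoothAt.koszul (hX : SmoothAt X p) (hY : SmoothAt Y p) (hZ : SmoothAt Z p) :
    CMDiffAt ∞ (AlmostHermitian.koszul X Y Z) p := by
  have h1 := SmoothAt.mvfderiv (hY.inner hZ) hX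
  have h2 := SmoothAt.mvfderiv (hX.inner hZ) hY
  have h3 := SmoothAt.mvfderiv (hX.inner hY) hZ
  exact ((((h1.add h2).sub h3).add ((hX.mlieBracket hY).inner hZ)).sub
    ((hX.mlieBracket hZ).inner hY)).sub ((hY.mlieBracket hZ).inner hX)

theorem contMDiffAt_det {ι : Type*} [Fintype ι] [DecidableEq ι] {A : M → Matrix ι ι ℝ}
    (hA : ∀ i j, CMDiffAt ∞ (fun q ↦ A q i j) p) : CMDiffAt ∞ (fun q ↦ (A q).det) p := by
  simp only [Matrix.det_apply']
  exact contMDiffAt_finsetSum fun σ _ ↦ contMDiffAt_const.mul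
    (contMDiffAt_finsetProd fun i _ ↦ hA _ _)

/-- A field is smooth as soon as its inner products with smooth fields are: its coefficients in a
local frame solve a linear system whose matrix is the Gram matrix of the frame. -/
theorem smoothAt_of_inner
    (h : ∀ Z : Π x : M, TangentSpace 𝓘(ℝ, E) x, SmoothAt Z p →
      CMDiffAt ∞ (fun q ↦ ⟪Z q, X q⟫_ℝ) p) : SmoothAt X p := by
  classical
  let e := trivializationAt E (TangentSpace 𝓘(ℝ, E) : M → Type _) p
  let b := Module.finBasis ℝ E
  have hp : p ∈ e.baseSet := FiberBundle.mem_baseSet_trivializationAt E _ p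
  let s := e.localFrame b
  have hs (i) : SmoothAt (s i) p := contMDiffAt_localFrame_of_mem ∞ e b i hp
  let G : M → Matrix _ _ ℝ := fun q ↦ Matrix.gram ℝ fun i ↦ s i q
  let r : M → Fin (Module.finrank ℝ E) → ℝ := fun q j ↦ ⟪s j q, X q⟫_ℝ
  have hG (i j) : CMDiffAt ∞ (fun q ↦ G q i j) p := (hs i).inner (hs j)
  have hr (j) : CMDiffAt ∞ (fun q ↦ r q j) p := h _ (hs j)
  have hdet (q) (hq : q ∈ e.baseSet) : (G q).det ≠ 0 :=
    (Matrix.posDef_gram_of_linearIndependent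
      ((e.isLocalFrameOn_localFrame_baseSet 𝓘(ℝ, E) 1 b).linearIndependent hq)).det_pos.ne'
  have hcramer (i) : CMDiffAt ∞ (fun q ↦ (G q).cramer (r q) i) p := by
    simp only [Matrix.cramer_apply]
    refine contMDiffAt_det fun k l ↦ ?_
    simp only [Matrix.updateCol_apply]
    split_ifs
    · exact hr k
    · exact hG k l
  refine (contMDiffAt_iff_localFrameCoeff b hp).2 fun i ↦ ?_
  refine ((hcramer i).div₀ (contMDiffAt_det hG) (hdet p hp)).congr_of_eventuallyEq ?_
  filter_upwards [e.open_baseSet.mem_nhds hp] with q hq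
  have hX := e.eq_sum_localFrameCoeff_smul (I := 𝓘(ℝ, E)) (b := b) (s := X) hq
  let c : Fin (Module.finrank ℝ E) → ℝ := fun i ↦ e.localFrameCoeff 𝓘(ℝ, E) b i q (X q)
  have hGc : (G q).mulVec c = r q := by
    ext j
    simp only [r, G, Matrix.mulVec, dotProduct, Matrix.gram_apply]
    conv_rhs => rw [hX]
    simp [inner_sum, inner_smul_right, c, s, mul_comm]
  change c i = (G q).cramer (r q) i / (G q).det
  rw [← hGc, eq_div_iff (hdet q hq), Matrix.cramer_eq_adjugate_mulVec, Matrix.mulVec_mulVec,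
    Matrix.adjugate_mul, Matrix.smul_mulVec, Matrix.one_mulVec]
  simp [mul_comm]

theorem SmoothAt.leviCivita (hX : SmoothAt X p) (hY : SmoothAt Y p) :
    SmoothAt (fun q ↦ AlmostHermitian.leviCivita Y q (X q)) p := by
  refine smoothAt_of_inner fun Z hZ ↦ ?_
  refine ((contMDiffAt_const (c := (1 / 2 : ℝ))).mul
    (SmoothAt.koszul hX hY hZ)).congr_of_eventuallyEq ?_
  filter_upwards [hX.eventually_mdiff, hY.eventually_mdiff, hZ.eventually_mdiff] with q h1 h2 h3
  have := two_mul_inner_leviCivitaFun h1 h2 h3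
  rw [real_inner_comm]
  change ⟪leviCivitaFun Y q (X q), Z q⟫_ℝ = 1 / 2 * AlmostHermitian.koszul X Y Z q
  rw [← this]
  ring

end SmoothFields

/-! ### Symmetries of the curvature -/

/-- The interchange of pairs follows from the other symmetries of a curvature tensor. -/
theorem pair_symm_of_skew_of_bianchi {α : Type*} {T : α → α → α → α → ℝ}
    (h₁ : ∀ x y z u, T x y z u = -T y x z u) (h₂ : ∀ x y z u, T x y z u = -T x y u z)
    (h₃ : ∀ x y z u, T x y z u + T y z x u + T z x y u = 0) (x y z u : α) :
    T x y z u = T z u x y := by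
  linarith [h₃ x y z u, h₃ y z u x, h₃ z u x y, h₃ u x y z, h₂ x y z u, h₁ y z x u, h₂ y z x u,
    h₁ z x y u, h₂ z x y u, h₁ z u y x, h₁ u y z x, h₁ u x z y, h₁ x z u y, h₁ x y u z,
    h₁ y u x z, h₂ z u x y, h₂ u y z x, h₂ u x z y, h₂ x z u y, h₂ y u x z, h₂ z u y x,
    h₁ u x y z, h₂ u x y z, h₁ x y z u, h₂ x z y u, h₁ y z u x]

section Curvature

variable {E : Type*} [NormedAddCommGroup E] [NormedSpace ℝ E] [FiniteDimensional ℝ E]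
  [CompleteSpace E]
  {M : Type*} [TopologicalSpace M] [ChartedSpace E M] [IsManifold 𝓘(ℝ, E) ∞ M]
  [RiemannianBundle (fun x : M ↦ TangentSpace 𝓘(ℝ, E) x)]
  [IsContMDiffRiemannianBundle 𝓘(ℝ, E) ∞ E (fun x : M ↦ TangentSpace 𝓘(ℝ, E) x)]
  {p : M} {X Y Z W : Π x : M, TangentSpace 𝓘(ℝ, E) x} {f g : M → ℝ}

theorem mvfderiv_congr (h : f =ᶠ[𝓝 p] g) :
    mvfderiv 𝓘(ℝ, E) f p = mvfderiv 𝓘(ℝ, E) g p := by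
  simp only [mvfderiv, h.mfderiv_eq]
  rfl

theorem leviCivita_congr (hX : SmoothAt X p) (hY : SmoothAt Y p) (h : ∀ᶠ q in 𝓝 p, X q = Y q) :
    leviCivita X p = leviCivita Y p :=
  leviCivita.isCovariantDerivativeOnUniv.congr_of_eventuallyEq hX.mdiff hY.mdiff univ_mem h

theorem leviCivita_add (hX : MDiffAt (T% X) p) (hY : MDiffAt (T% Y) p) :
    leviCivita (X + Y) p = leviCivita X p + leviCivita Y p :=
  leviCivita.isCovariantDerivativeOnUniv.add hX hY

theorem leviCivita_smul (hf : MDiffAt f p) (hX : MDiffAt (T% X) p) (v : TangentSpace 𝓘(ℝ, E) p) :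
    leviCivita (f • X) p v = f p • leviCivita X p v + mvfderiv 𝓘(ℝ, E) f p v • X p := by
  have := leviCivita.isCovariantDerivativeOnUniv.leibniz (x := p) hX hf
  exact congrArg (fun L ↦ L v) this

theorem leviCivita_sub (hX : MDiffAt (T% X) p) (hY : MDiffAt (T% Y) p) :
    leviCivita (X - Y) p = leviCivita X p - leviCivita Y p := by
  have h : X - Y = X + (fun _ : M ↦ (-1 : ℝ)) • Y := by
    ext q; simp [sub_eq_add_neg]
  have hf : MDiffAt (fun _ : M ↦ (-1 : ℝ)) p := mdifferentiableAt_const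
  rw [h, leviCivita_add hX (hf.smul_section hY)]
  ext v
  simp [leviCivita_smul hf hY, sub_eq_add_neg, mvfderiv_const]

/-- The Levi-Civita connection has no torsion. -/
theorem leviCivita_sub_leviCivita (hX : MDiffAt (T% X) p) (hY : MDiffAt (T% Y) p) :
    leviCivita Y p (X p) - leviCivita X p (Y p) = VectorField.mlieBracket 𝓘(ℝ, E) X Y p :=
  (CovariantDerivative.torsion_eq_zero_iff _).1 leviCivita_torsion hX hY

theorem mlieBracket_mlieBracket_smul (X : Π x : M, TangentSpace 𝓘(ℝ, E) x)
    (hY : SmoothAt Y p) (hZ : SmoothAt Z p)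
    (hf : CMDiffAt ∞ f p) :
    VectorField.mlieBracket 𝓘(ℝ, E) X (VectorField.mlieBracket 𝓘(ℝ, E) Y (f • Z)) p
      = mvfderiv 𝓘(ℝ, E) (fun q ↦ mvfderiv 𝓘(ℝ, E) f q (Y q)) p (X p) • Z p
        + mvfderiv 𝓘(ℝ, E) f p (Y p) • VectorField.mlieBracket 𝓘(ℝ, E) X Z p
        + mvfderiv 𝓘(ℝ, E) f p (X p) • VectorField.mlieBracket 𝓘(ℝ, E) Y Z p
        + f p • VectorField.mlieBracket 𝓘(ℝ, E) X (VectorField.mlieBracket 𝓘(ℝ, E) Y Z) p := by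
  have h : VectorField.mlieBracket 𝓘(ℝ, E) Y (f • Z) =ᶠ[𝓝 p]
      (fun q ↦ mvfderiv 𝓘(ℝ, E) f q (Y q)) • Z + f • VectorField.mlieBracket 𝓘(ℝ, E) Y Z := by
    filter_upwards [hZ.eventually_mdiff, eventually_mdifferentiableAt hf] with q h1 h2
    exact VectorField.mlieBracket_smul_right h2 h1
  have hYf := SmoothAt.mvfderiv hf hY
  have hYZ := hY.mlieBracket hZ
  rw [EventuallyEq.rfl.mlieBracket_vectorField_eq h,
    VectorField.mlieBracket_add_right (SmoothAt.smul hYf hZ).mdiff (SmoothAt.smul hf hYZ).mdiff,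
    VectorField.mlieBracket_smul_right (hYf.mdifferentiableAt (by simp)) hZ.mdiff,
    VectorField.mlieBracket_smul_right (hf.mdifferentiableAt (by simp)) hYZ.mdiff]
  abel

/-- The Lie bracket is the commutator of directional derivatives. This is what is left of the Jacobi
identity for `X`, `Y`, `f • Z` after that for `X`, `Y`, `Z` is subtracted, for a field `Z` that does
not vanish at `p`. -/
theorem mvfderiv_mlieBracket (hX : SmoothAt X p) (hY : SmoothAt Y p) (hf : CMDiffAt ∞ f p) :
    mvfderiv 𝓘(ℝ, E) f p (VectorField.mlieBracket 𝓘(ℝ, E) X Y p)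
      = mvfderiv 𝓘(ℝ, E) (fun q ↦ mvfderiv 𝓘(ℝ, E) f q (Y q)) p (X p)
        - mvfderiv 𝓘(ℝ, E) (fun q ↦ mvfderiv 𝓘(ℝ, E) f q (X q)) p (Y p) := by
  by_cases hz : ∃ z : TangentSpace 𝓘(ℝ, E) p, z ≠ 0
  · obtain ⟨z, hz⟩ := hz
    have hZ := smoothAt_extend z
    have hfZ := SmoothAt.smul hf hZ
    have e1 := VectorField.leibniz_identity_mlieBracket_apply
      (ContMDiffAt.of_le hX (by simp; norm_cast)) (ContMDiffAt.of_le hY (by simp; norm_cast))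
      (ContMDiffAt.of_le hfZ (by simp; norm_cast))
    have e2 := VectorField.leibniz_identity_mlieBracket_apply
      (ContMDiffAt.of_le hX (by simp; norm_cast)) (ContMDiffAt.of_le hY (by simp; norm_cast))
      (ContMDiffAt.of_le hZ (by simp; norm_cast))
    rw [mlieBracket_mlieBracket_smul X hY hZ hf, mlieBracket_mlieBracket_smul Y hX hZ hf,
      VectorField.mlieBracket_smul_right (hf.mdifferentiableAt (by simp)) hZ.mdiff, e2,
      FiberBundle.extend_apply_self] at e1
    have e3 : (mvfderiv 𝓘(ℝ, E) f p (VectorField.mlieBracket 𝓘(ℝ, E) X Y p)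
      - (mvfderiv 𝓘(ℝ, E) (fun q ↦ mvfderiv 𝓘(ℝ, E) f q (Y q)) p (X p)
        - mvfderiv 𝓘(ℝ, E) (fun q ↦ mvfderiv 𝓘(ℝ, E) f q (X q)) p (Y p))) • z = 0 := by
      linear_combination (norm := module) -e1
    exact sub_eq_zero.1 ((smul_eq_zero.1 e3).resolve_right hz)
  · push Not at hz
    simp [hz]

theorem curvatureOfFields_swap (X Y Z : Π x : M, TangentSpace 𝓘(ℝ, E) x) :
    curvatureOfFields X Y Z p = -curvatureOfFields Y X Z p := by
  rw [curvatureOfFields, curvatureOfFields, VectorField.mlieBracket_swap_apply (V := X), map_neg]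
  abel

theorem curvatureOfFields_bianchi (hX : SmoothAt X p) (hY : SmoothAt Y p) (hZ : SmoothAt Z p) :
    curvatureOfFields X Y Z p + curvatureOfFields Y Z X p + curvatureOfFields Z X Y p = 0 := by
  have key {A B C : Π x : M, TangentSpace 𝓘(ℝ, E) x} (hA : SmoothAt A p) (hB : SmoothAt B p)
      (hC : SmoothAt C p) :
      leviCivita (fun q ↦ leviCivita C q (B q)) p (A p)
        - leviCivita (fun q ↦ leviCivita B q (C q)) p (A p)
        - leviCivita A p (VectorField.mlieBracket 𝓘(ℝ, E) B C p)
        = VectorField.mlieBracket 𝓘(ℝ, E) A (VectorField.mlieBracket 𝓘(ℝ, E) B C) p := by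
    have hBC := hB.mlieBracket hC
    rw [← leviCivita_sub_leviCivita hA.mdiff hBC.mdiff]
    congr 1
    rw [← sub_apply, ← leviCivita_sub (hB.leviCivita hC).mdiff (hC.leviCivita hB).mdiff]
    refine congrArg (fun L ↦ L (A p)) (leviCivita_congr
      ((hB.leviCivita hC).sub (hC.leviCivita hB)) hBC ?_)
    filter_upwards [hB.eventually_mdiff, hC.eventually_mdiff] with q h1 h2
    exact leviCivita_sub_leviCivita h1 h2
  have e := VectorField.leibniz_identity_mlieBracket_apply
    (ContMDiffAt.of_le hX (by simp; norm_cast)) (ContMDiffAt.of_le hY (by simp; norm_cast))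
    (ContMDiffAt.of_le hZ (by simp; norm_cast))
  have k1 := key hX hY hZ
  have k2 := key hY hZ hX
  have k3 := key hZ hX hY
  rw [VectorField.mlieBracket_swap_apply (V := VectorField.mlieBracket 𝓘(ℝ, E) X Y) (W := Z)] at e
  have h2 : VectorField.mlieBracket 𝓘(ℝ, E) Y (VectorField.mlieBracket 𝓘(ℝ, E) X Z) p
      = -VectorField.mlieBracket 𝓘(ℝ, E) Y (VectorField.mlieBracket 𝓘(ℝ, E) Z X) p := by
    rw [VectorField.mlieBracket_swap (V := X) (W := Z)]
    have := VectorField.mlieBracket_const_smul_right (I := 𝓘(ℝ, E)) (c := (-1 : ℝ)) (V := Y)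
      (hZ.mlieBracket hX).mdiff
    simpa using this
  rw [h2] at e
  simp only [curvatureOfFields]
  linear_combination (norm := module) k1 + k2 + k3 + e

theorem mvfderiv_mvfderiv_inner (hX : SmoothAt X p) (hY : SmoothAt Y p) (hZ : SmoothAt Z p)
    (hW : SmoothAt W p) :
    mvfderiv 𝓘(ℝ, E) (fun q ↦ mvfderiv 𝓘(ℝ, E) (fun r ↦ ⟪Z r, W r⟫_ℝ) q (Y q)) p (X p)
      = ⟪leviCivita (fun q ↦ leviCivita Z q (Y q)) p (X p), W p⟫_ℝ
        + ⟪leviCivita Z p (Y p), leviCivita W p (X p)⟫_ℝ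
        + ⟪leviCivita Z p (X p), leviCivita W p (Y p)⟫_ℝ
        + ⟪Z p, leviCivita (fun q ↦ leviCivita W q (Y q)) p (X p)⟫_ℝ := by
  have hYZ := hY.leviCivita hZ
  have hYW := hY.leviCivita hW
  have h : (fun q ↦ mvfderiv 𝓘(ℝ, E) (fun r ↦ ⟪Z r, W r⟫_ℝ) q (Y q)) =ᶠ[𝓝 p]
      fun q ↦ ⟪leviCivita Z q (Y q), W q⟫_ℝ + ⟪Z q, leviCivita W q (Y q)⟫_ℝ := by
    filter_upwards [hY.eventually_mdiff, hZ.eventually_mdiff, hW.eventually_mdiff] with q h1 h2 h3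
    exact leviCivita_metric h1 h2 h3
  rw [mvfderiv_congr h, mvfderiv_fun_add (mdifferentiableAt_inner hYZ.mdiff hW.mdiff)
    (mdifferentiableAt_inner hZ.mdiff hYW.mdiff), add_apply,
    leviCivita_metric hX.mdiff hYZ.mdiff hW.mdiff, leviCivita_metric hX.mdiff hZ.mdiff hYW.mdiff]
  ring

theorem inner_curvatureOfFields_swap (hX : SmoothAt X p) (hY : SmoothAt Y p) (hZ : SmoothAt Z p)
    (hW : SmoothAt W p) :
    ⟪curvatureOfFields X Y Z p, W p⟫_ℝ = -⟪curvatureOfFields X Y W p, Z p⟫_ℝ := by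
  have e := mvfderiv_mlieBracket hX hY (hZ.inner hW)
  rw [mvfderiv_mvfderiv_inner hX hY hZ hW, mvfderiv_mvfderiv_inner hY hX hZ hW,
    leviCivita_metric (hX.mlieBracket hY).mdiff hZ.mdiff hW.mdiff] at e
  simp only [curvatureOfFields, inner_sub_left]
  rw [real_inner_comm (Z p), real_inner_comm (Z p), real_inner_comm (Z p)] at *
  linarith

theorem inner_curvatureOfFields_pair_symm (hX : SmoothAt X p) (hY : SmoothAt Y p)
    (hZ : SmoothAt Z p) (hW : SmoothAt W p) :
    ⟪curvatureOfFields X Y Z p, W p⟫_ℝ = ⟪curvatureOfFields Z W X p, Y p⟫_ℝ := by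
  refine pair_symm_of_skew_of_bianchi
    (α := {X : Π x : M, TangentSpace 𝓘(ℝ, E) x // SmoothAt X p})
    (T := fun X Y Z W ↦ ⟪curvatureOfFields X.1 Y.1 Z.1 p, W.1 p⟫_ℝ) ?_ ?_ ?_
    ⟨X, hX⟩ ⟨Y, hY⟩ ⟨Z, hZ⟩ ⟨W, hW⟩
  · intro X Y Z W
    rw [curvatureOfFields_swap, inner_neg_left]
  · intro X Y Z W
    exact inner_curvatureOfFields_swap X.2 Y.2 Z.2 W.2
  · intro X Y Z W
    rw [← inner_add_left, ← inner_add_left, curvatureOfFields_bianchi X.2 Y.2 Z.2, inner_zero_left]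

/-- The curvature may be computed with arbitrary smooth extensions of the tangent vectors. No
Leibniz rule is needed: `⟪R(X, Y)Z, W⟫` visibly depends on `W` through its value at `p` only, and
the symmetries move every argument into that place. -/
theorem inner_curvatureOfFields_congr {X' Y' Z' W' : Π x : M, TangentSpace 𝓘(ℝ, E) x}
    (hX : SmoothAt X p) (hY : SmoothAt Y p) (hZ : SmoothAt Z p)
    (hX' : SmoothAt X' p) (hY' : SmoothAt Y' p) (hZ' : SmoothAt Z' p) (hW' : SmoothAt W' p)
    (eX : X p = X' p) (eY : Y p = Y' p) (eZ : Z p = Z' p) (eW : W p = W' p) :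
    ⟪curvatureOfFields X Y Z p, W p⟫_ℝ = ⟪curvatureOfFields X' Y' Z' p, W' p⟫_ℝ := by
  have key {A B C D C' D' : Π x : M, TangentSpace 𝓘(ℝ, E) x} (hA : SmoothAt A p)
      (hB : SmoothAt B p) (hC : SmoothAt C p) (hD' : SmoothAt D' p) (hC' : SmoothAt C' p)
      (eC : C p = C' p) (eD : D p = D' p) :
      ⟪curvatureOfFields A B C p, D p⟫_ℝ = ⟪curvatureOfFields A B C' p, D' p⟫_ℝ := by
    rw [eD, inner_curvatureOfFields_swap hA hB hC hD', eC,
      ← inner_curvatureOfFields_swap hA hB hC' hD']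
  rw [key hX hY hZ hW' hZ' eZ eW, inner_curvatureOfFields_pair_symm hX hY hZ' hW',
    key hZ' hW' hX hY' hX' eX eY, inner_curvatureOfFields_pair_symm hZ' hW' hX' hY']

theorem inner_curvatureOfFields (hX : SmoothAt X p) (hY : SmoothAt Y p) (hZ : SmoothAt Z p)
    (w : TangentSpace 𝓘(ℝ, E) p) :
    ⟪curvatureOfFields X Y Z p, w⟫_ℝ = curvature₄ p (X p) (Y p) (Z p) w := by
  have := inner_curvatureOfFields_congr hX hY hZ (smoothAt_extend (X p))
    (smoothAt_extend (Y p)) (smoothAt_extend (Z p)) (smoothAt_extend w)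
    (W := FiberBundle.extend E w) (by simp) (by simp) (by simp) rfl
  simpa [curvature₄, curvature] using this

theorem curvatureOfFields_eq_curvature (hX : SmoothAt X p) (hY : SmoothAt Y p)
    (hZ : SmoothAt Z p) : curvatureOfFields X Y Z p = curvature p (X p) (Y p) (Z p) :=
  ext_inner_right ℝ fun w ↦ inner_curvatureOfFields hX hY hZ w

end Curvature

/-- An algebraic curvature tensor: a quadrilinear form with the symmetries of `⟪R(x, y)z, u⟫`.
Linearity is only asked for in the last argument; the symmetries carry it to the others. -/
structure IsCurvatureLike {V : Type*} [AddCommGroup V] [Module ℝ V] (T : V → V → V → V → ℝ) :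
    Prop where
  swap_left : ∀ x y z u, T x y z u = -T y x z u
  swap_right : ∀ x y z u, T x y z u = -T x y u z
  bianchi : ∀ x y z u, T x y z u + T y z x u + T z x y u = 0
  add : ∀ x y z u v, T x y z (u + v) = T x y z u + T x y z v
  smul : ∀ x y z u (a : ℝ), T x y z (a • u) = a * T x y z u

theorem isCurvatureLike_curvature₄ {E : Type*} [NormedAddCommGroup E] [NormedSpace ℝ E]
    [FiniteDimensional ℝ E] [CompleteSpace E]
    {M : Type*} [TopologicalSpace M] [ChartedSpace E M] [IsManifold 𝓘(ℝ, E) ∞ M]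
    [RiemannianBundle (fun x : M ↦ TangentSpace 𝓘(ℝ, E) x)]
    [IsContMDiffRiemannianBundle 𝓘(ℝ, E) ∞ E (fun x : M ↦ TangentSpace 𝓘(ℝ, E) x)] (p : M) :
    IsCurvatureLike (V := TangentSpace 𝓘(ℝ, E) p) (curvature₄ p) where
  swap_left x y z u := by
    rw [curvature₄, curvature, curvatureOfFields_swap, inner_neg_left]; rfl
  swap_right x y z u := by
    have := inner_curvatureOfFields_swap (smoothAt_extend x) (smoothAt_extend y)
      (smoothAt_extend z) (smoothAt_extend u)
    simpa [curvature₄, curvature] using this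
  bianchi x y z u := by
    have := curvatureOfFields_bianchi (smoothAt_extend x) (smoothAt_extend y) (smoothAt_extend z)
    rw [curvature₄, curvature₄, curvature₄, ← inner_add_left, ← inner_add_left, curvature,
      curvature, curvature, this, inner_zero_left]
  add x y z u v := by rw [curvature₄, inner_add_right]; rfl
  smul x y z u a := by rw [curvature₄, real_inner_smul_right]; rfl

/-! ### Slice charts of immersed submanifolds -/

section Submanifold

variable {E : Type v} [NormedAddCommGroup E] [NormedSpace ℝ E] [FiniteDimensional ℝ E]
  [CompleteSpace E]
  {M : Type*} [TopologicalSpace M] [ChartedSpace E M] [IsManifold 𝓘(ℝ, E) ∞ M]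
  [RiemannianBundle (fun x : M ↦ TangentSpace 𝓘(ℝ, E) x)]
  [IsContMDiffRiemannianBundle 𝓘(ℝ, E) ∞ E (fun x : M ↦ TangentSpace 𝓘(ℝ, E) x)]

/-- The constant vector field on a vector space. -/
def constField (w : E) : Π x : E, TangentSpace 𝓘(ℝ, E) x := fun _ ↦ w

theorem contMDiffAt_constField (w x : E) :
    ContMDiffAt 𝓘(ℝ, E) 𝓘(ℝ, E).tangent ∞ (T% (constField w)) x :=
  contMDiffAt_vectorSpace_iff_contDiffAt.2 contDiffAt_const

theorem mlieBracket_constField (v w x : E) :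
    VectorField.mlieBracket 𝓘(ℝ, E) (constField v) (constField w) x = 0 := by
  rw [← VectorField.mlieBracketWithin_univ, VectorField.mlieBracketWithin_eq_lieBracketWithin]
  change fderivWithin ℝ (constField w) Set.univ x v - fderivWithin ℝ (constField v) Set.univ x w = 0
  have h (u : E) : fderivWithin ℝ (constField u) Set.univ x = 0 := fderivWithin_const_apply u
  rw [h, h, zero_apply, zero_apply, sub_zero]

/-- The vector field on the domain of the chart `φ` whose coordinates are constantly `w`. -/
def coordinateField (φ : OpenPartialHomeomorph M E) (w : E) : Π x : M, TangentSpace 𝓘(ℝ, E) x :=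
  VectorField.mpullback 𝓘(ℝ, E) 𝓘(ℝ, E) φ (constField w)

section Chart

variable {φ : OpenPartialHomeomorph M E} (hφ : φ ∈ IsManifold.maximalAtlas 𝓘(ℝ, E) ∞ M)
include hφ

theorem isInvertible_mfderiv_of_mem_maximalAtlas {q : M} (hq : q ∈ φ.source) :
    (mfderiv 𝓘(ℝ, E) 𝓘(ℝ, E) φ q).IsInvertible := by
  have h : φ.MDifferentiable 𝓘(ℝ, E) 𝓘(ℝ, E) :=
    ⟨(contMDiffOn_of_mem_maximalAtlas hφ).mdifferentiableOn (by simp),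
      (contMDiffOn_symm_of_mem_maximalAtlas hφ).mdifferentiableOn (by simp)⟩
  exact ⟨h.mfderiv hq, rfl⟩

theorem smoothAt_coordinateField (w : E) {q : M} (hq : q ∈ φ.source) :
    SmoothAt (coordinateField φ w) q := by
  exact ContMDiffAt.mpullback_vectorField_preimage (n := ∞) (contMDiffAt_constField w (φ q))
    (contMDiffAt_of_mem_maximalAtlas hφ hq) (isInvertible_mfderiv_of_mem_maximalAtlas hφ hq)
    (by simp)

theorem mlieBracket_coordinateField (v w : E) {q : M} (hq : q ∈ φ.source) :
    VectorField.mlieBracket 𝓘(ℝ, E) (coordinateField φ v) (coordinateField φ w) q = 0 := by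
  have h (u : E) := (contMDiffAt_constField u (φ q)).mdifferentiableAt (by simp)
  rw [coordinateField, coordinateField, ← VectorField.mpullback_mlieBracket (n := ∞) (h v) (h w)
    (contMDiffAt_of_mem_maximalAtlas hφ hq) (by simp; norm_cast), VectorField.mpullback_apply,
    mlieBracket_constField, map_zero]

end Chart

variable (n : ℕ) {N : Type*} [TopologicalSpace N] [ChartedSpace (EuclideanSpace ℝ (Fin n)) N]
  [IsManifold (𝓡 n) ∞ N]

/-- Charts `ψ` of `N` and `φ` of `M` near `a` and `f a` in which `f` is the inclusion of the first
factor of `ℝⁿ × F`. -/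
structure IsSliceChart {F : Type*} [NormedAddCommGroup F] [NormedSpace ℝ F] (f : N → M) (a : N)
    (ψ : OpenPartialHomeomorph N (EuclideanSpace ℝ (Fin n))) (φ : OpenPartialHomeomorph M E)
    (L : (EuclideanSpace ℝ (Fin n) × F) ≃L[ℝ] E) : Prop where
  mem_source : a ∈ ψ.source
  mem_atlas_left : ψ ∈ IsManifold.maximalAtlas (𝓡 n) ∞ N
  mem_atlas : φ ∈ IsManifold.maximalAtlas 𝓘(ℝ, E) ∞ M
  maps_to : ∀ b ∈ ψ.source, f b ∈ φ.source
  apply_eq : ∀ b ∈ ψ.source, φ (f b) = L (ψ b, 0)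

variable {n}

theorem exists_isSliceChart {f : N → M} (hf : IsImmersion (𝓡 n) 𝓘(ℝ, E) ∞ f) (a : N) :
    ∃ (F : Type v) (_ : NormedAddCommGroup F) (_ : NormedSpace ℝ F)
      (ψ : OpenPartialHomeomorph N (EuclideanSpace ℝ (Fin n))) (φ : OpenPartialHomeomorph M E)
      (L : (EuclideanSpace ℝ (Fin n) × F) ≃L[ℝ] E), IsSliceChart n f a ψ φ L := by
  obtain ⟨F, i1, i2, h⟩ := hf.isImmersionAt a
  refine ⟨F, i1, i2, h.domChart, h.codChart, h.equiv, h.mem_domChart_source,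
    h.domChart_mem_maximalAtlas, h.codChart_mem_maximalAtlas,
    fun b hb ↦ h.source_subset_preimage_source hb, fun b hb ↦ ?_⟩
  have := h.writtenInCharts ((h.domChart.extend (𝓡 n)).map_source
    (by rwa [OpenPartialHomeomorph.extend_source]))
  simpa [h.domChart.left_inv hb] using this

section Slice

variable {F : Type*} [NormedAddCommGroup F] [NormedSpace ℝ F] {f : N → M} {a : N}
  {ψ : OpenPartialHomeomorph N (EuclideanSpace ℝ (Fin n))} {φ : OpenPartialHomeomorph M E}
  {L : (EuclideanSpace ℝ (Fin n) × F) ≃L[ℝ] E}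

theorem IsSliceChart.coordinateField_apply (h : IsSliceChart n f a ψ φ L)
    (hf : ContMDiff (𝓡 n) 𝓘(ℝ, E) ∞ f) {b : N} (hb : b ∈ ψ.source)
    (u : TangentSpace (𝓡 n) b) :
    coordinateField φ (L (mfderiv (𝓡 n) (𝓡 n) ψ b u, 0)) (f b)
      = mfderiv (𝓡 n) 𝓘(ℝ, E) f b u := by
  have hinv := isInvertible_mfderiv_of_mem_maximalAtlas h.mem_atlas (h.maps_to b hb)
  have hψ : MDifferentiableAt (𝓡 n) (𝓡 n) ψ b :=
    (contMDiffAt_of_mem_maximalAtlas h.mem_atlas_left hb).mdifferentiableAt (by simp)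
  have hφ : MDifferentiableAt 𝓘(ℝ, E) 𝓘(ℝ, E) φ (f b) :=
    (contMDiffAt_of_mem_maximalAtlas h.mem_atlas (h.maps_to b hb)).mdifferentiableAt (by simp)
  let i : EuclideanSpace ℝ (Fin n) →L[ℝ] E :=
    (L : (EuclideanSpace ℝ (Fin n) × F) →L[ℝ] E).comp (ContinuousLinearMap.inl ℝ _ F)
  have e : (φ ∘ f) =ᶠ[𝓝 b] (i ∘ ψ) := by
    filter_upwards [ψ.open_source.mem_nhds hb] with c hc
    exact h.apply_eq c hc
  have e1 := mfderiv_comp b hφ ((hf b).mdifferentiableAt (by simp))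
  have e2 := mfderiv_comp (I'' := 𝓘(ℝ, E)) b i.mdifferentiableAt hψ
  rw [i.mfderiv_eq] at e2
  rw [e.mfderiv_eq, e2] at e1
  have e3 : L (mfderiv (𝓡 n) (𝓡 n) ψ b u, 0)
      = mfderiv 𝓘(ℝ, E) 𝓘(ℝ, E) φ (f b) (mfderiv (𝓡 n) 𝓘(ℝ, E) f b u) :=
    congrArg (fun T ↦ T u) e1
  rw [e3]
  exact hinv.inverse_apply_eq.2 rfl

/-- Near `a`, the coordinate fields of a slice chart in the directions of the slice are tangent to
the submanifold. -/
theorem IsSliceChart.isTangentNear_coordinateField (h : IsSliceChart n f a ψ φ L)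
    (hf : ContMDiff (𝓡 n) 𝓘(ℝ, E) ∞ f) (v : EuclideanSpace ℝ (Fin n)) {b : N}
    (hb : b ∈ ψ.source) : IsTangentNear n f b (coordinateField φ (L (v, 0))) := by
  refine ⟨smoothAt_coordinateField h.mem_atlas _ (h.maps_to b hb), ?_⟩
  filter_upwards [ψ.open_source.mem_nhds hb] with c hc
  have hψ : ψ.MDifferentiable (𝓡 n) (𝓡 n) :=
    ⟨(contMDiffOn_of_mem_maximalAtlas h.mem_atlas_left).mdifferentiableOn (by simp),
      (contMDiffOn_symm_of_mem_maximalAtlas h.mem_atlas_left).mdifferentiableOn (by simp)⟩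
  obtain ⟨u, hu⟩ := hψ.mfderiv_surjective hc v
  refine ⟨u, ?_⟩
  rw [← hu]
  exact (h.coordinateField_apply hf hc u).symm

/-- A smooth section of `TM` along the submanifold extends to a smooth field on `M` near `f a`: in a
trivialization of `TM`, precompose it with the projection of the slice chart. -/
theorem IsSliceChart.exists_extension (h : IsSliceChart n f a ψ φ L)
    (hf : ContMDiff (𝓡 n) 𝓘(ℝ, E) ∞ f) {H : Π b : N, TangentSpace 𝓘(ℝ, E) (f b)}
    (hH : ContMDiff (𝓡 n) 𝓘(ℝ, E).tangent ∞ (fun b ↦ (⟨f b, H b⟩ : TangentBundle 𝓘(ℝ, E) M))) :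
    ∃ ξ : Π x : M, TangentSpace 𝓘(ℝ, E) x, SmoothAt ξ (f a) ∧ ∀ᶠ b in 𝓝 a, ξ (f b) = H b := by
  let e := trivializationAt E (TangentSpace 𝓘(ℝ, E) : M → Type _) (f a)
  have ha : f a ∈ e.baseSet := FiberBundle.mem_baseSet_trivializationAt E _ (f a)
  let r : M → N := fun q ↦ ψ.symm (L.symm (φ q)).1
  have hr (b : N) (hb : b ∈ ψ.source) : r (f b) = b := by
    simp [r, h.apply_eq b hb, ψ.left_inv hb]
  have hφ := contMDiffAt_of_mem_maximalAtlas h.mem_atlas (h.maps_to a h.mem_source)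
  have hπ : ContMDiffAt 𝓘(ℝ, E) (𝓡 n) ∞ (fun q ↦ (L.symm (φ q)).1) (f a) := by
    let i : E →L[ℝ] EuclideanSpace ℝ (Fin n) :=
      (ContinuousLinearMap.fst ℝ _ F).comp (L.symm : E →L[ℝ] (EuclideanSpace ℝ (Fin n) × F))
    exact i.contMDiff.contMDiffAt.comp (f a) hφ
  have hrs : ContMDiffAt 𝓘(ℝ, E) (𝓡 n) ∞ r (f a) := by
    refine ContMDiffAt.comp (f a) (contMDiffAt_symm_of_mem_maximalAtlas h.mem_atlas_left ?_) hπ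
    simp [h.apply_eq a h.mem_source, ψ.map_source h.mem_source]
  have hHr := (hH (r (f a))).comp (f a) hrs
  have hcoord : ContMDiffAt 𝓘(ℝ, E) 𝓘(ℝ, E) ∞ (fun q ↦ (e ⟨f (r q), H (r q)⟩).2) (f a) := by
    refine ((e.contMDiffAt_iff (IB := 𝓘(ℝ, E)) ?_).1 hHr).2
    rw [e.mem_source]
    simpa [hr a h.mem_source] using ha
  refine ⟨fun q ↦ e.symm q (e ⟨f (r q), H (r q)⟩).2, ?_, ?_⟩
  · refine (e.contMDiffAt_section_iff ha).2 (hcoord.congr_of_eventuallyEq ?_)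
    filter_upwards [e.open_baseSet.mem_nhds ha] with q hq
    simp [hq]
  · filter_upwards [ψ.open_source.mem_nhds h.mem_source,
      (hf a).continuousAt (e.open_baseSet.mem_nhds ha)] with b hb hb'
    have key : ∀ c : N, c = b → e.symm (f b) (e ⟨f c, H c⟩).2 = H b := by
      rintro c rfl
      exact e.symm_apply_apply_mk hb' (H c)
    exact key _ (hr b hb)

end Slice

/-! ### The Codazzi equation of totally umbilical submanifolds -/

theorem normalPart_add (f : N → M) (a : N) (v w : TangentSpace 𝓘(ℝ, E) (f a)) :
    normalPart n f a (v + w) = normalPart n f a v + normalPart n f a w := map_add _ v w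

theorem normalPart_sub (f : N → M) (a : N) (v w : TangentSpace 𝓘(ℝ, E) (f a)) :
    normalPart n f a (v - w) = normalPart n f a v - normalPart n f a w := map_sub _ v w

theorem normalPart_smul (f : N → M) (a : N) (c : ℝ) (v : TangentSpace 𝓘(ℝ, E) (f a)) :
    normalPart n f a (c • v) = c • normalPart n f a v := map_smul _ c v

theorem normalPart_of_mem {f : N → M} {a : N} {v : TangentSpace 𝓘(ℝ, E) (f a)}
    (h : v ∈ (tangentSubspace n f a)ᗮ) : normalPart n f a v = v :=
  Submodule.starProjection_eq_self_iff.2 h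

theorem sub_normalPart_mem (f : N → M) (a : N) (v : TangentSpace 𝓘(ℝ, E) (f a)) :
    v - normalPart n f a v ∈ tangentSubspace n f a := by
  have := Submodule.sub_starProjection_mem_orthogonal (K := (tangentSubspace n f a)ᗮ) v
  rwa [Submodule.orthogonal_orthogonal] at this

theorem mem_of_normalPart_eq_zero {f : N → M} {a : N} {v : TangentSpace 𝓘(ℝ, E) (f a)}
    (h : normalPart n f a v = 0) : v ∈ tangentSubspace n f a := by
  simpa [h] using sub_normalPart_mem (n := n) f a v

/-- Near `a`, the second fundamental form of `f` is `⟪X, Y⟫ ξ` for a field `ξ` that is normal at `a`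
and parallel at `a` in the normal bundle. -/
structure IsUmbilicalNear (n : ℕ) {N : Type*} [TopologicalSpace N]
    [ChartedSpace (EuclideanSpace ℝ (Fin n)) N] (f : N → M) (a : N)
    (ξ : Π x : M, TangentSpace 𝓘(ℝ, E) x) : Prop where
  smooth : SmoothAt ξ (f a)
  normal : ∀ᶠ b in 𝓝 a, ξ (f b) ∈ (tangentSubspace n f b)ᗮ
  second : ∀ᶠ b in 𝓝 a, ∀ X Y : Π x : M, TangentSpace 𝓘(ℝ, E) x, IsTangentNear n f b X →
    IsTangentNear n f b Y →
      normalPart n f b (leviCivita Y (f b) (X (f b))) = ⟪X (f b), Y (f b)⟫_ℝ • ξ (f b)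
  parallel : ∀ v ∈ tangentSubspace n f a, normalPart n f a (leviCivita ξ (f a) v) = 0

variable {f : N → M} {a : N} {ξ X Y Z : Π x : M, TangentSpace 𝓘(ℝ, E) x}

theorem IsUmbilicalNear.normalPart_leviCivita_leviCivita (h : IsUmbilicalNear n f a ξ)
    (hX : ∀ᶠ b in 𝓝 a, IsTangentNear n f b X) (hY : ∀ᶠ b in 𝓝 a, IsTangentNear n f b Y)
    (hZ : ∀ᶠ b in 𝓝 a, IsTangentNear n f b Z) :
    normalPart n f a (leviCivita (fun q ↦ leviCivita Z q (Y q)) (f a) (X (f a)))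
      = (⟪X (f a), leviCivita Z (f a) (Y (f a))⟫_ℝ
          + mvfderiv 𝓘(ℝ, E) (fun q ↦ ⟪Y q, Z q⟫_ℝ) (f a) (X (f a))) • ξ (f a) := by
  have sX : SmoothAt X (f a) := hX.self_of_nhds.1
  have sY : SmoothAt Y (f a) := hY.self_of_nhds.1
  have sZ : SmoothAt Z (f a) := hZ.self_of_nhds.1
  have tX : X (f a) ∈ tangentSubspace n f a := hX.self_of_nhds.2.self_of_nhds
  have hYZ := sY.inner sZ
  have sξ := SmoothAt.smul hYZ h.smooth
  have sD := sY.leviCivita sZ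
  -- `T` is the part of `∇_Y Z` tangent to the submanifold
  let T : Π x : M, TangentSpace 𝓘(ℝ, E) x :=
    (fun q ↦ leviCivita Z q (Y q)) - (fun q ↦ ⟪Y q, Z q⟫_ℝ) • ξ
  have sT : SmoothAt T (f a) := sD.sub sξ
  have hT : IsTangentNear n f a T := by
    refine ⟨sT, ?_⟩
    filter_upwards [h.second, hY, hZ] with b hb hbY hbZ
    have := sub_normalPart_mem (n := n) f b (leviCivita Z (f b) (Y (f b)))
    rwa [hb Y Z hbY hbZ] at this
  have e1 := h.second.self_of_nhds X T hX.self_of_nhds hT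
  have hdec : (fun q ↦ leviCivita Z q (Y q)) = T + (fun q ↦ ⟪Y q, Z q⟫_ℝ) • ξ := by
    simp [T]
  have hXT : ⟪X (f a), T (f a)⟫_ℝ = ⟪X (f a), leviCivita Z (f a) (Y (f a))⟫_ℝ := by
    have : ⟪X (f a), ξ (f a)⟫_ℝ = 0 := h.normal.self_of_nhds _ tX
    simp [T, inner_sub_right, real_inner_smul_right, this]
  rw [hdec, leviCivita_add sT.mdiff sξ.mdiff, add_apply, normalPart_add, e1, hXT,
    leviCivita_smul (hYZ.mdifferentiableAt (by simp)) h.smooth.mdiff, normalPart_add,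
    normalPart_smul, normalPart_smul, h.parallel _ tX, normalPart_of_mem h.normal.self_of_nhds]
  module

/-- The Codazzi equation for a totally umbilical submanifold with parallel mean curvature vector,
on commuting fields. -/
theorem IsUmbilicalNear.normalPart_curvatureOfFields (h : IsUmbilicalNear n f a ξ)
    (hX : ∀ᶠ b in 𝓝 a, IsTangentNear n f b X) (hY : ∀ᶠ b in 𝓝 a, IsTangentNear n f b Y)
    (hZ : ∀ᶠ b in 𝓝 a, IsTangentNear n f b Z)
    (hXY : VectorField.mlieBracket 𝓘(ℝ, E) X Y (f a) = 0) :
    normalPart n f a (curvatureOfFields X Y Z (f a)) = 0 := by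
  have sX : SmoothAt X (f a) := hX.self_of_nhds.1
  have sY : SmoothAt Y (f a) := hY.self_of_nhds.1
  have sZ : SmoothAt Z (f a) := hZ.self_of_nhds.1
  rw [curvatureOfFields, hXY, map_zero, sub_zero, normalPart_sub,
    h.normalPart_leviCivita_leviCivita hX hY hZ, h.normalPart_leviCivita_leviCivita hY hX hZ,
    leviCivita_metric sX.mdiff sY.mdiff sZ.mdiff, leviCivita_metric sY.mdiff sX.mdiff sZ.mdiff,
    ← sub_smul]
  have e := leviCivita_sub_leviCivita sX.mdiff sY.mdiff
  rw [hXY, sub_eq_zero] at e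
  rw [e, smul_eq_zero]
  exact Or.inl (by ring)

/-- The tangent spaces of the submanifold are invariant under the curvature of `M`. -/
theorem IsUmbilicalNear.curvature_mem (hf : IsImmersion (𝓡 n) 𝓘(ℝ, E) ∞ f)
    (h : IsUmbilicalNear n f a ξ) {x y z : TangentSpace 𝓘(ℝ, E) (f a)}
    (hx : x ∈ tangentSubspace n f a) (hy : y ∈ tangentSubspace n f a)
    (hz : z ∈ tangentSubspace n f a) : curvature (f a) x y z ∈ tangentSubspace n f a := by
  obtain ⟨F, _, _, ψ, φ, L, hs⟩ := exists_isSliceChart hf a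
  have hmem := hs.maps_to a hs.mem_source
  have ext (v : TangentSpace 𝓘(ℝ, E) (f a)) (hv : v ∈ tangentSubspace n f a) :
      ∃ w, coordinateField φ (L (w, 0)) (f a) = v := by
    obtain ⟨u, rfl⟩ := hv
    exact ⟨_, hs.coordinateField_apply hf.contMDiff hs.mem_source u⟩
  have tan (w : EuclideanSpace ℝ (Fin n)) :
      ∀ᶠ b in 𝓝 a, IsTangentNear n f b (coordinateField φ (L (w, 0))) := by
    filter_upwards [ψ.open_source.mem_nhds hs.mem_source] with b hb
    exact hs.isTangentNear_coordinateField hf.contMDiff w hb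
  have sm (w : E) := smoothAt_coordinateField hs.mem_atlas w hmem
  obtain ⟨x, rfl⟩ := ext x hx
  obtain ⟨y, rfl⟩ := ext y hy
  obtain ⟨z, rfl⟩ := ext z hz
  rw [← curvatureOfFields_eq_curvature (sm _) (sm _) (sm _)]
  exact mem_of_normalPart_eq_zero (h.normalPart_curvatureOfFields (tan x) (tan y) (tan z)
    (mlieBracket_coordinateField hs.mem_atlas _ _ hmem))

theorem IsTotallyGeodesic.isUmbilicalNear (h : IsTotallyGeodesic (E := E) n f) (a : N) :
    IsUmbilicalNear n f a (0 : Π x : M, TangentSpace 𝓘(ℝ, E) x) where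
  smooth := contMDiff_zeroSection (IB := 𝓘(ℝ, E)) ℝ (TangentSpace 𝓘(ℝ, E) : M → Type _) (f a)
  normal := Eventually.of_forall fun b ↦ Submodule.zero_mem _
  second := Eventually.of_forall fun b X Y hX hY ↦ by
    simpa [secondFundamentalForm] using h b X Y hX hY
  parallel v _ := by
    have h0 := (leviCivita (M := M) (E := E)).zero
    rw [h0]
    exact map_zero _

theorem IsTotallyUmbilical.exists_isUmbilicalNear (hf : IsImmersion (𝓡 n) 𝓘(ℝ, E) ∞ f)
    {H : Π b : N, TangentSpace 𝓘(ℝ, E) (f b)} (h : IsTotallyUmbilical n f H)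
    (hH : IsParallelNormal n f H) (a : N) :
    ∃ ξ : Π x : M, TangentSpace 𝓘(ℝ, E) x, IsUmbilicalNear n f a ξ := by
  obtain ⟨F, _, _, ψ, φ, L, hs⟩ := exists_isSliceChart hf a
  obtain ⟨ξ, sξ, hξ⟩ := hs.exists_extension hf.contMDiff h.1.1
  refine ⟨ξ, sξ, ?_, ?_, hH a ξ sξ hξ⟩
  · filter_upwards [hξ] with b hb
    rw [hb]
    exact h.1.2 b
  · filter_upwards [hξ] with b hb X Y hX hY
    rw [hb]
    exact h.2 b X Y hX hY

end Submanifold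

section Axioms

variable {E : Type*} [NormedAddCommGroup E] [NormedSpace ℝ E] [FiniteDimensional ℝ E]
  [CompleteSpace E]
  {M : Type u} [TopologicalSpace M] [ChartedSpace E M] [IsManifold 𝓘(ℝ, E) ∞ M]
  [RiemannianBundle (fun x : M ↦ TangentSpace 𝓘(ℝ, E) x)]
  [IsContMDiffRiemannianBundle 𝓘(ℝ, E) ∞ E (fun x : M ↦ TangentSpace 𝓘(ℝ, E) x)]
  {S : AlmostHermitianStructure E M} {n : ℕ}

/-- Either axiom makes all antiholomorphic `n`-dimensional subspaces curvature invariant. -/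
theorem curvature_mem_of_axiom
    (hax : S.AxiomOfAntiholomorphicPlanes n ∨ S.AxiomOfAntiholomorphicSpheres n) {p : M}
    {α : Submodule ℝ (TangentSpace 𝓘(ℝ, E) p)} (hα : Module.finrank ℝ α = n)
    (hS : S.IsAntiholomorphic α) {x y z : TangentSpace 𝓘(ℝ, E) p} (hx : x ∈ α) (hy : y ∈ α)
    (hz : z ∈ α) : curvature p x y z ∈ α := by
  rcases hax with hax | hax
  · obtain ⟨N, _, _, _, f, a, rfl, hf, rfl, hg⟩ := hax p α hα hS
    exact (hg.isUmbilicalNear a).curvature_mem hf hx hy hz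
  · obtain ⟨N, _, _, _, f, a, rfl, hf, rfl, H, hu, -, hp⟩ := hax p α hα hS
    obtain ⟨ξ, hξ⟩ := IsTotallyUmbilical.exists_isUmbilicalNear hf hu hp a
    exact hξ.curvature_mem hf hx hy hz

end Axioms

/-! ### Sectional curvature of antiholomorphic planes -/

section Algebra

variable {V : Type*} [NormedAddCommGroup V] [InnerProductSpace ℝ V]

namespace IsCurvatureLike

variable {T D : V → V → V → V → ℝ} (hT : IsCurvatureLike T)
include hT

theorem pair_symm (x y z u : V) : T x y z u = T z u x y :=
  pair_symm_of_skew_of_bianchi hT.swap_left hT.swap_right hT.bianchi x y z u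

theorem add_third (x y z z' u : V) : T x y (z + z') u = T x y z u + T x y z' u := by
  rw [hT.swap_right, hT.add, hT.swap_right x y z, hT.swap_right x y z']; ring

theorem smul_third (x y z u : V) (a : ℝ) : T x y (a • z) u = a * T x y z u := by
  rw [hT.swap_right, hT.smul, hT.swap_right x y z]; ring

theorem add_second (x y y' z u : V) : T x (y + y') z u = T x y z u + T x y' z u := by
  rw [hT.pair_symm, hT.add, hT.pair_symm x y, hT.pair_symm x y']

theorem smul_second (x y z u : V) (a : ℝ) : T x (a • y) z u = a * T x y z u := by
  rw [hT.pair_symm, hT.smul, hT.pair_symm x y]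

theorem add_first (x x' y z u : V) : T (x + x') y z u = T x y z u + T x' y z u := by
  rw [hT.pair_symm, hT.add_third, hT.pair_symm x y, hT.pair_symm x' y]

theorem smul_first (x y z u : V) (a : ℝ) : T (a • x) y z u = a * T x y z u := by
  rw [hT.pair_symm, hT.smul_third, hT.pair_symm x y]

theorem self_left (x z u : V) : T x x z u = 0 := by linarith [hT.swap_left x x z u]

theorem self_right (x y z : V) : T x y z z = 0 := by linarith [hT.swap_right x y z z]

/-- The form `T x · · u` has the transpose `T u · · x`. -/
theorem reverse (x y z u : V) : T x y z u = T u z y x := by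
  rw [hT.pair_symm, hT.swap_left, hT.swap_right, neg_neg]

theorem sub (hD : IsCurvatureLike D) : IsCurvatureLike fun x y z u ↦ T x y z u - D x y z u where
  swap_left x y z u := by rw [hT.swap_left, hD.swap_left]; ring
  swap_right x y z u := by rw [hT.swap_right, hD.swap_right]; ring
  bianchi x y z u := by linarith [hT.bianchi x y z u, hD.bianchi x y z u]
  add x y z u v := by rw [hT.add, hD.add]; ring
  smul x y z u a := by rw [hT.smul, hD.smul]; ring

/-- A curvature tensor is determined by its sectional curvatures. -/
theorem eq_zero_of_sectional (h : ∀ x y, T x y y x = 0) (x y z u : V) : T x y z u = 0 := by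
  have h1 (x y z : V) : T x y z x = 0 := by
    have := h x (y + z)
    rw [hT.add_second, hT.add_third, hT.add_third, h, h, hT.reverse x z y x] at this
    linarith
  have h2 (x y z u : V) : T x y z u = -T u y z x := by
    have := h1 (x + u) y z
    rw [hT.add_first, hT.add, hT.add, h1, h1] at this
    linarith
  -- so `T` is skew in its first and third arguments, hence invariant under cyclic permutations
  have h3 (x y z u : V) : T x y z u = -T z y x u := by
    rw [hT.swap_right, h2, hT.swap_right, neg_neg]
  have h4 (x y z u : V) : T y z x u = T x y z u := by
    rw [hT.swap_left, h3, neg_neg]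
  linarith [hT.bianchi x y z u, h4 x y z u, h4 y z x u]

end IsCurvatureLike

/-- An orthogonal complex structure on a Euclidean space. -/
structure IsOrthogonalComplex (J : V →ₗ[ℝ] V) : Prop where
  apply_apply : ∀ v, J (J v) = -v
  inner_apply_apply : ∀ v w, ⟪J v, J w⟫_ℝ = ⟪v, w⟫_ℝ

/-- The vectors `x` and `y` are orthogonal for the Hermitian form of `J`; equivalently, they are
orthogonal and span an antiholomorphic subspace. -/
def HermitianOrthogonal (J : V →ₗ[ℝ] V) (x y : V) : Prop := ⟪x, y⟫_ℝ = 0 ∧ ⟪x, J y⟫_ℝ = 0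

variable {J : V →ₗ[ℝ] V} (hJ : IsOrthogonalComplex J)

section

include hJ

namespace IsOrthogonalComplex

theorem inner_left (x y : V) : ⟪J x, y⟫_ℝ = -⟪x, J y⟫_ℝ := by
  rw [← hJ.inner_apply_apply, hJ.apply_apply, inner_neg_left]

theorem inner_right (x y : V) : ⟪x, J y⟫_ℝ = -⟪y, J x⟫_ℝ := by
  rw [← hJ.inner_left, real_inner_comm]

theorem inner_self (x : V) : ⟪x, J x⟫_ℝ = 0 := by linarith [hJ.inner_right x x]

end IsOrthogonalComplex

namespace HermitianOrthogonal

variable {x y z : V}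

theorem symm (h : HermitianOrthogonal J x y) : HermitianOrthogonal J y x :=
  ⟨by rw [real_inner_comm, h.1], by rw [hJ.inner_right, h.2, neg_zero]⟩

omit hJ in
theorem add (hy : HermitianOrthogonal J x y) (hz : HermitianOrthogonal J x z) :
    HermitianOrthogonal J x (y + z) := by
  constructor
  · rw [inner_add_right, hy.1, hz.1, add_zero]
  · rw [map_add, inner_add_right, hy.2, hz.2, add_zero]

omit hJ in
theorem smul (hy : HermitianOrthogonal J x y) (a : ℝ) : HermitianOrthogonal J x (a • y) := by
  constructor
  · rw [real_inner_smul_right, hy.1, mul_zero]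
  · rw [map_smul, real_inner_smul_right, hy.2, mul_zero]

theorem map (h : HermitianOrthogonal J x y) : HermitianOrthogonal J x (J y) :=
  ⟨h.2, by rw [hJ.apply_apply, inner_neg_right, h.1, neg_zero]⟩

end HermitianOrthogonal

/-- The decomposition of `x` into its component in the complex line of `e` and a vector Hermitian
orthogonal to `e`. -/
theorem exists_decomposition {e : V} (he : e ≠ 0) (x : V) :
    ∃ (a b : ℝ) (w : V), x = a • e + b • J e + w ∧ HermitianOrthogonal J e w := by
  have he' : ⟪e, e⟫_ℝ ≠ 0 := inner_self_ne_zero.2 he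
  have h1 : ⟪J e, J e⟫_ℝ = ⟪e, e⟫_ℝ := hJ.inner_apply_apply e e
  have h2 := hJ.inner_self e
  have key : HermitianOrthogonal J e
      (x - (⟪e, x⟫_ℝ / ⟪e, e⟫_ℝ) • e - (⟪J e, x⟫_ℝ / ⟪e, e⟫_ℝ) • J e) := by
    constructor
    · simp only [inner_sub_right, real_inner_smul_right, h2]
      field_simp
      ring
    · rw [← neg_eq_zero, ← hJ.inner_left]
      simp only [inner_sub_right, real_inner_smul_right, h1, real_inner_comm e, h2]
      field_simp
      ring
  exact ⟨_, _, _, by abel, key⟩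

theorem exists_hermitianOrthogonal [FiniteDimensional ℝ V] (hV : 2 < Module.finrank ℝ V) (e : V) :
    ∃ f : V, f ≠ 0 ∧ HermitianOrthogonal J e f := by
  have hlt : Module.finrank ℝ (Submodule.span ℝ {e, J e}) < Module.finrank ℝ V := by
    classical
    have := finrank_span_finset_le_card (R := ℝ) ({e, J e} : Finset V)
    simp only [Finset.coe_insert, Finset.coe_singleton] at this
    exact (this.trans Finset.card_le_two).trans_lt hV
  have hne : (Submodule.span ℝ {e, J e})ᗮ ≠ ⊥ := fun h ↦ by
    rw [Submodule.orthogonal_eq_bot_iff] at h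
    rw [h, finrank_top] at hlt
    exact lt_irrefl _ hlt
  obtain ⟨f, hf, hf0⟩ := Submodule.exists_mem_ne_zero_of_ne_bot hne
  refine ⟨f, hf0, hf e (Submodule.subset_span (by simp)), ?_⟩
  rw [← neg_eq_zero, ← hJ.inner_left]
  exact hf (J e) (Submodule.subset_span (by simp))

end

/-- The model curvature tensor `R₁` of constant sectional curvature. -/
def modelR₁ (x y z u : V) : ℝ := ⟪x, u⟫_ℝ * ⟪y, z⟫_ℝ - ⟪x, z⟫_ℝ * ⟪y, u⟫_ℝ

/-- The model curvature tensor `R₂` built from the complex structure `J`. -/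
def modelR₂ (J : V →ₗ[ℝ] V) (x y z u : V) : ℝ :=
  ⟪x, J u⟫_ℝ * ⟪y, J z⟫_ℝ - ⟪x, J z⟫_ℝ * ⟪y, J u⟫_ℝ - 2 * ⟪x, J y⟫_ℝ * ⟪z, J u⟫_ℝ

theorem isCurvatureLike_model (hJ : IsOrthogonalComplex J) (k l : ℝ) :
    IsCurvatureLike fun x y z u : V ↦ k * modelR₁ x y z u + l * modelR₂ J x y z u where
  swap_left x y z u := by
    simp only [modelR₁, modelR₂]
    rw [hJ.inner_right y x]; ring
  swap_right x y z u := by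
    simp only [modelR₁, modelR₂]
    rw [hJ.inner_right u z]; ring
  bianchi x y z u := by
    simp only [modelR₁, modelR₂]
    rw [hJ.inner_right y x, hJ.inner_right z x, hJ.inner_right z y, real_inner_comm x y,
      real_inner_comm x z, real_inner_comm y z]
    ring
  add x y z u v := by
    simp only [modelR₁, modelR₂, map_add, inner_add_right]; ring
  smul x y z u a := by
    simp only [modelR₁, modelR₂, map_smul, real_inner_smul_right]; ring

/-- The condition on a curvature tensor that is left of either axiom: `R(x, y)y` is a multiple of
`x` for all Hermitian orthogonal `x` and `y`. -/
def IsAntiholomorphicFlat (J : V →ₗ[ℝ] V) (T : V → V → V → V → ℝ) : Prop :=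
  ∀ x y z, HermitianOrthogonal J x y → ⟪x, z⟫_ℝ = 0 → ⟪y, z⟫_ℝ = 0 → T x y y z = 0

namespace IsCurvatureLike

variable {T : V → V → V → V → ℝ} (hT : IsCurvatureLike T) (hA : IsAntiholomorphicFlat J T)
include hT hJ hA

theorem antiholomorphic_const_right {x y z : V} (hy : HermitianOrthogonal J x y)
    (hz : HermitianOrthogonal J x z) : ⟪z, z⟫_ℝ * T x y y x = ⟪y, y⟫_ℝ * T x z z x := by
  -- `y` and `z` are rescaled to vectors of the same length, whose sum and difference are orthogonal
  have key {y z : V} (hy : HermitianOrthogonal J x y) (hz : HermitianOrthogonal J x z)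
      (h : ⟪y, y⟫_ℝ = ⟪z, z⟫_ℝ) : T x y y x = T x z z x := by
    have h1 : HermitianOrthogonal J x (y + (-1 : ℝ) • z) := hy.add (hz.smul _)
    have h2 := hA _ _ (y + (-1 : ℝ) • z) ((hy.add hz).symm hJ)
      (by simp only [inner_add_left, inner_add_right, real_inner_smul_right, real_inner_comm y z]
          linarith) h1.1
    simp only [hT.add_first, hT.add, hT.smul] at h2
    linarith [hT.reverse z x x y, hT.pair_symm y x x y, hT.pair_symm z x x z]
  have h := key (hy.smul ‖z‖) (hz.smul ‖y‖) (by
    simp only [real_inner_smul_left, real_inner_smul_right]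
    rw [real_inner_self_eq_norm_sq, real_inner_self_eq_norm_sq]; ring)
  simp only [hT.smul_second, hT.smul_third] at h
  rw [real_inner_self_eq_norm_sq, real_inner_self_eq_norm_sq]
  linarith

/-- The antiholomorphic sectional curvatures at a point agree. Through the symmetry in `x` and `y`,
the preceding lemma compares the planes of `(x, y)` and `(e, f)` when `x` is in the complex line of
`e` or Hermitian orthogonal to it; a general `x = p + w` is reached by a rotation in the plane of
`p` and `w`. -/
theorem antiholomorphic_const {e f : V} (he : ⟪e, e⟫_ℝ = 1) (hf : ⟪f, f⟫_ℝ = 1)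
    (hef : HermitianOrthogonal J e f) {x y : V} (hxy : HermitianOrthogonal J x y) :
    T x y y x = T e f f e * (⟪x, x⟫_ℝ * ⟪y, y⟫_ℝ) := by
  have he0 : e ≠ 0 := fun h ↦ by simp [h] at he
  obtain ⟨a, b, w, hx, hw⟩ := exists_decomposition hJ he0 x
  set p := a • e + b • J e
  have hort {v : V} (hv : HermitianOrthogonal J e v) : HermitianOrthogonal J v p :=
    ((hv.symm hJ).smul a).add (((hv.symm hJ).map hJ).smul b)
  have h1 {v : V} (hv : HermitianOrthogonal J e v) :
      T e v v e = T e f f e * ⟪v, v⟫_ℝ := by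
    have := hT.antiholomorphic_const_right hJ hA hv hef
    rw [hf] at this
    linarith
  have h2 {v : V} (hv : HermitianOrthogonal J e v) :
      T p v v p = T e f f e * (⟪p, p⟫_ℝ * ⟪v, v⟫_ℝ) := by
    have := hT.antiholomorphic_const_right hJ hA (hort hv) (hv.symm hJ)
    rw [he, hT.pair_symm v p, hT.pair_symm v e, h1 hv] at this
    linarith
  have hpw := hort hw
  by_cases hp0 : p = 0
  · have hxw : x = w := by rw [hx, hp0, zero_add]
    subst hxw
    have := hT.antiholomorphic_const_right hJ hA hxy (hw.symm hJ)
    rw [he, ← hT.pair_symm e, h1 hw] at this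
    linarith
  by_cases hw0 : w = 0
  · have hxp : x = p := by rw [hx, hw0, add_zero]
    rw [hxp] at hxy ⊢
    have := hT.antiholomorphic_const_right hJ hA hxy ((hort hef).symm hJ)
    rw [hf, h2 hef, hf] at this
    linarith
  have hpp : ⟪p, p⟫_ℝ ≠ 0 := inner_self_ne_zero.2 hp0
  have hww : ⟪w, w⟫_ℝ ≠ 0 := inner_self_ne_zero.2 hw0
  have hwp : ⟪w, p⟫_ℝ = 0 := hpw.1
  have hpw' : ⟪p, w⟫_ℝ = 0 := (hpw.symm hJ).1
  have hwJp : ⟪w, J p⟫_ℝ = 0 := hpw.2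
  have hpJw : ⟪p, J w⟫_ℝ = 0 := (hpw.symm hJ).2
  have hxx : ⟪x, x⟫_ℝ = ⟪p, p⟫_ℝ + ⟪w, w⟫_ℝ := by
    rw [hx]; simp only [inner_add_left, inner_add_right, hwp, hpw']; ring
  have hxx0 : ⟪x, x⟫_ℝ ≠ 0 := by
    have := real_inner_self_nonneg (x := p)
    have := real_inner_self_nonneg (x := w)
    rw [hxx]
    positivity
  -- `y'` is orthogonal to `x` in the plane of `p` and `w`
  let y' := ⟪w, w⟫_ℝ • p + (-⟪p, p⟫_ℝ) • w
  have hxy' : HermitianOrthogonal J x y' := by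
    rw [hx]
    constructor
    · simp only [y', inner_add_left, inner_add_right, real_inner_smul_right, hwp, hpw']; ring
    · simp only [y', map_add, map_smul, inner_add_left, inner_add_right, real_inner_smul_right,
        hwJp, hpJw, hJ.inner_self]
      ring
  have hyy' : ⟪y', y'⟫_ℝ = ⟪p, p⟫_ℝ * ⟪w, w⟫_ℝ * ⟪x, x⟫_ℝ := by
    rw [hxx]
    simp only [y', inner_add_left, inner_add_right, real_inner_smul_right, real_inner_smul_left,
      hwp, hpw']
    ring
  have hQ : T x y' y' x = ⟪x, x⟫_ℝ ^ 2 * T p w w p := by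
    rw [hxx, hx]
    simp only [y', hT.add_first, hT.add_second, hT.add_third, hT.add, hT.smul_second,
      hT.smul_third, hT.self_left, hT.self_right]
    rw [hT.swap_left w p p w, hT.swap_right p w p w, hT.swap_left w p w p]
    ring
  have := hT.antiholomorphic_const_right hJ hA hxy hxy'
  rw [hyy', hQ, h2 hw] at this
  refine mul_left_cancel₀ (mul_ne_zero (mul_ne_zero hpp hww) hxx0) ?_
  linarith

end IsCurvatureLike

end Algebra

/-! ### Holomorphic curvature and the form of the curvature tensor -/

section Algebra

variable {V : Type*} [NormedAddCommGroup V] [InnerProductSpace ℝ V] {J : V →ₗ[ℝ] V}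
  (hJ : IsOrthogonalComplex J)

namespace IsCurvatureLike

variable {T : V → V → V → V → ℝ} (hT : IsCurvatureLike T) (hA : IsAntiholomorphicFlat J T)
include hT hJ hA

theorem mixed_eq_zero {x y : V} (h : HermitianOrthogonal J x y) :
    T x (J x) (J x) y = 0 ∧ T x (J x) (J y) x = 0 ∧ T x (J y) (J x) x = 0 ∧
      T y (J x) (J x) x = 0 := by
  have h1 : T y (J x) (J x) x = 0 := by
    refine hA _ _ _ ?_ (h.symm hJ).1 (by rw [hJ.inner_left, hJ.inner_self, neg_zero])
    exact ⟨(h.symm hJ).2, by rw [hJ.apply_apply, inner_neg_right, (h.symm hJ).1, neg_zero]⟩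
  have h2 : T (J y) x x (J x) = 0 :=
    hA _ _ _ ((h.map hJ).symm hJ) (by rw [hJ.inner_apply_apply, (h.symm hJ).1]) (hJ.inner_self x)
  refine ⟨by rw [hT.reverse, h1], ?_, ?_, h1⟩
  · rw [hT.pair_symm, h2]
  · rw [hT.reverse, hT.pair_symm, h2]

/-- The bracketed sum is half the part of `T (x + y) (J (x + y)) (J (x + y)) (x + y)` that is
quadratic in `x` and in `y`. Its value, and the comparison of the holomorphic sectional curvatures
of `x` and `y`, are read off from `T x' (J x') (J x') y' = 0` for orthogonal `x'`, `y'` in the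
plane of `x` and `y`. -/
theorem holomorphic_relations {x y : V} (h : HermitianOrthogonal J x y)
    (hK : T y (J x) (J x) y = T x (J y) (J y) x) :
    ⟪x, x⟫_ℝ * (T x (J x) (J y) y + T x (J y) (J x) y + T y (J x) (J x) y)
        = ⟪y, y⟫_ℝ * T x (J x) (J x) x ∧
      ⟪y, y⟫_ℝ * (T x (J x) (J y) y + T x (J y) (J x) y + T y (J x) (J x) y)
        = ⟪x, x⟫_ℝ * T y (J y) (J y) y := by
  obtain ⟨x1, x2, x3, x4⟩ := hT.mixed_eq_zero hJ hA h
  obtain ⟨y1, y2, y3, y4⟩ := hT.mixed_eq_zero hJ hA (h.symm hJ)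
  have s1 : T y (J y) (J x) x = T x (J x) (J y) y := by
    rw [hT.pair_symm, hT.swap_left, hT.swap_right, neg_neg]
  have s2 : T y (J x) (J y) x = T x (J y) (J x) y := hT.reverse _ _ _ _
  have key (a b : ℝ) :
      a ^ 3 * b * (⟪x, x⟫_ℝ * (T x (J x) (J y) y + T x (J y) (J x) y + T y (J x) (J x) y)
        - ⟪y, y⟫_ℝ * T x (J x) (J x) x)
      + a * b ^ 3 * (⟪x, x⟫_ℝ * T y (J y) (J y) y
        - ⟪y, y⟫_ℝ * (T x (J x) (J y) y + T x (J y) (J x) y + T y (J x) (J x) y)) = 0 := by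
    have hxy : HermitianOrthogonal J (a • x + b • y)
        ((-b * ⟪y, y⟫_ℝ) • x + (a * ⟪x, x⟫_ℝ) • y) := by
      constructor
      · simp only [inner_add_left, inner_add_right, real_inner_smul_left, real_inner_smul_right,
          h.1, (h.symm hJ).1]
        ring
      · simp only [map_add, map_smul, inner_add_left, inner_add_right, real_inner_smul_left,
          real_inner_smul_right, h.2, (h.symm hJ).2, hJ.inner_self]
        ring
    have e := (hT.mixed_eq_zero hJ hA hxy).1
    simp only [map_add, map_smul, hT.add_first, hT.add_second, hT.add_third, hT.add,
      hT.smul_first, hT.smul_second, hT.smul_third, hT.smul, x1, x2, x3, x4, y1, y2, y3, y4,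
      s1, s2, ← hK] at e
    linear_combination e
  constructor
  · linarith [key 1 1, key 1 2]
  · linarith [key 1 1, key 1 2]

theorem exists_holomorphic_const [FiniteDimensional ℝ V] (hV : 2 < Module.finrank ℝ V) {κ : ℝ}
    (hκ : ∀ x y, HermitianOrthogonal J x y → T x y y x = κ * (⟪x, x⟫_ℝ * ⟪y, y⟫_ℝ)) :
    ∃ c : ℝ, ∀ x, T x (J x) (J x) x = c * ⟪x, x⟫_ℝ ^ 2 := by
  have hrel {x y : V} (h : HermitianOrthogonal J x y) := hT.holomorphic_relations hJ hA h (by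
    rw [hκ _ _ (h.map hJ), hκ _ _ ((h.symm hJ).map hJ), hJ.inner_apply_apply,
      hJ.inner_apply_apply]
    ring)
  have hcomp {x y : V} (h : HermitianOrthogonal J x y) :
      ⟪y, y⟫_ℝ ^ 2 * T x (J x) (J x) x = ⟪x, x⟫_ℝ ^ 2 * T y (J y) (J y) y := by
    obtain ⟨h1, h2⟩ := hrel h
    linear_combination ⟪x, x⟫_ℝ * h2 - ⟪y, y⟫_ℝ * h1
  by_cases hV0 : ∃ e : V, e ≠ 0
  swap
  · push Not at hV0
    refine ⟨0, fun x ↦ ?_⟩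
    rw [hV0 x, map_zero, hT.self_left, zero_mul]
  obtain ⟨e, he0⟩ := hV0
  obtain ⟨f, hf0, hef⟩ := exists_hermitianOrthogonal hJ hV e
  have he : ⟪e, e⟫_ℝ ≠ 0 := inner_self_ne_zero.2 he0
  have hf : ⟪f, f⟫_ℝ ≠ 0 := inner_self_ne_zero.2 hf0
  obtain ⟨c, hc⟩ : ∃ c, c = T e (J e) (J e) e / ⟪e, e⟫_ℝ ^ 2 := ⟨_, rfl⟩
  have hw {w : V} (h : HermitianOrthogonal J e w) : T w (J w) (J w) w = c * ⟪w, w⟫_ℝ ^ 2 := by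
    have := hcomp h
    rw [hc]
    field_simp
    linarith
  refine ⟨c, fun x ↦ ?_⟩
  obtain ⟨a, b, w, hx, hew⟩ := exists_decomposition hJ he0 x
  obtain ⟨p, hp⟩ : ∃ p, p = a • e + b • J e := ⟨_, rfl⟩
  rw [← hp] at hx
  have hort {v : V} (hv : HermitianOrthogonal J e v) : HermitianOrthogonal J p v := by
    rw [hp]
    exact (((hv.symm hJ).smul a).add (((hv.symm hJ).map hJ).smul b)).symm hJ
  have hpc : T p (J p) (J p) p = c * ⟪p, p⟫_ℝ ^ 2 := by
    have := hcomp (hort hef)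
    rw [hw hef] at this
    refine mul_left_cancel₀ (pow_ne_zero 2 hf) ?_
    linarith
  by_cases hp0 : p = 0
  · rw [hx, hp0, zero_add, hw hew]
  have hpp : ⟪p, p⟫_ℝ ≠ 0 := inner_self_ne_zero.2 hp0
  have hpw := hort hew
  obtain ⟨x1, x2, x3, x4⟩ := hT.mixed_eq_zero hJ hA hpw
  obtain ⟨y1, y2, y3, y4⟩ := hT.mixed_eq_zero hJ hA (hpw.symm hJ)
  have s1 : T w (J w) (J p) p = T p (J p) (J w) w := by
    rw [hT.pair_symm, hT.swap_left, hT.swap_right, neg_neg]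
  have s2 : T w (J p) (J w) p = T p (J w) (J p) w := hT.reverse _ _ _ _
  have s3 : T w (J p) (J p) w = T p (J w) (J w) p := by
    rw [hκ _ _ ((hpw.symm hJ).map hJ), hκ _ _ (hpw.map hJ), hJ.inner_apply_apply,
      hJ.inner_apply_apply]
    ring
  have hS : T p (J p) (J w) w + T p (J w) (J p) w + T w (J p) (J p) w
      = c * (⟪p, p⟫_ℝ * ⟪w, w⟫_ℝ) := by
    refine mul_left_cancel₀ hpp ?_
    rw [(hrel hpw).1, hpc]
    ring
  rw [hx]
  simp only [map_add, hT.add_first, hT.add_second, hT.add_third, hT.add, x1, x2, x3, x4, y1, y2,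
    y3, y4, s1, s2, ← s3, inner_add_left, inner_add_right, hpw.1, (hpw.symm hJ).1, hpc, hw hew]
  linear_combination 2 * hS

/-- An algebraic curvature tensor for which `R(x, y)y` is a multiple of `x` for all Hermitian
orthogonal `x`, `y` is that of a generalized complex space form. -/
theorem exists_eq_model [FiniteDimensional ℝ V] (hV : 2 < Module.finrank ℝ V) :
    ∃ c K : ℝ, ∀ x y z u, T x y z u = K * modelR₁ x y z u + (c - K) / 3 * modelR₂ J x y z u := by
  obtain ⟨v, hv⟩ : ∃ v : V, v ≠ 0 := by
    have : Nontrivial V := Module.nontrivial_of_finrank_pos (R := ℝ) (by omega)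
    exact exists_ne 0
  obtain ⟨w, hw, hvw⟩ := exists_hermitianOrthogonal hJ hV v
  have unit {v : V} (hv : v ≠ 0) : ⟪‖v‖⁻¹ • v, ‖v‖⁻¹ • v⟫_ℝ = 1 := by
    rw [real_inner_smul_left, real_inner_smul_right, real_inner_self_eq_norm_sq]
    have := norm_ne_zero_iff.2 hv
    field_simp
  have hef : HermitianOrthogonal J (‖v‖⁻¹ • v) (‖w‖⁻¹ • w) :=
    (((hvw.smul _).symm hJ).smul _).symm hJ
  have hK (x y : V) (h : HermitianOrthogonal J x y) :=
    hT.antiholomorphic_const hJ hA (unit hv) (unit hw) hef h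
  generalize T (‖v‖⁻¹ • v) (‖w‖⁻¹ • w) (‖w‖⁻¹ • w) (‖v‖⁻¹ • v) = K at hK
  obtain ⟨c, hc⟩ := hT.exists_holomorphic_const hJ hA hV hK
  refine ⟨c, K, fun x y z u ↦ sub_eq_zero.1 ?_⟩
  refine (hT.sub (isCurvatureLike_model hJ K ((c - K) / 3))).eq_zero_of_sectional (fun x y ↦ ?_)
    x y z u
  simp only [modelR₁, modelR₂]
  by_cases hx : x = 0
  · subst hx
    have h0 : T 0 y y 0 = 0 := by
      have := hT.smul_first 0 y y 0 0
      rwa [zero_smul, zero_mul] at this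
    simp [h0]
  obtain ⟨a, b, w, rfl, hxw⟩ := exists_decomposition hJ hx y
  have h1 : T w x x (J x) = 0 := hA _ _ _ (hxw.symm hJ) (hxw.symm hJ).2 (hJ.inner_self x)
  have h2 : T x (J x) w x = 0 := by rw [hT.pair_symm, h1]
  have h3 : T x w (J x) x = 0 := by rw [hT.reverse, h2]
  simp only [hT.add_second, hT.add_third, hT.smul_second, hT.smul_third, hT.self_left,
    hT.self_right, h2, h3, hc, hK x w hxw, map_add, map_smul, inner_add_left, inner_add_right,
    real_inner_smul_left, real_inner_smul_right, hJ.inner_self, hJ.apply_apply, inner_neg_right,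
    hJ.inner_apply_apply, hxw.1, hxw.2, (hxw.symm hJ).1, (hxw.symm hJ).2, hJ.inner_left]
  ring

end IsCurvatureLike

/-! ### Antiholomorphic subspaces through a pair of vectors -/

/-- The subspace `α` is antiholomorphic for `J`. -/
def IsTotallyReal (J : V →ₗ[ℝ] V) (α : Submodule ℝ V) : Prop :=
  ∀ x ∈ α, ∀ y ∈ α, ⟪J x, y⟫_ℝ = 0

include hJ in
/-- An antiholomorphic subspace orthogonal to `z` extends to an antiholomorphic subspace of any
dimension `n ≤ m` that is still orthogonal to `z`: for `dim α < m`, the space `α + Jα + ℝz` has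
dimension less than `2m`. -/
theorem IsTotallyReal.exists_extension [FiniteDimensional ℝ V] {m n : ℕ} (hnm : n ≤ m)
    (hV : Module.finrank ℝ V = 2 * m) (z : V) {k : ℕ} (α : Submodule ℝ V)
    (hα : IsTotallyReal J α) (hz : ∀ x ∈ α, ⟪x, z⟫_ℝ = 0) (hk : Module.finrank ℝ α + k = n) :
    ∃ β, α ≤ β ∧ IsTotallyReal J β ∧ (∀ x ∈ β, ⟪x, z⟫_ℝ = 0) ∧ Module.finrank ℝ β = n := by
  induction k generalizing α with
  | zero => exact ⟨α, le_rfl, hα, hz, hk⟩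
  | succ k ih =>
    let γ := α ⊔ α.map J ⊔ Submodule.span ℝ {z}
    have hγ : Module.finrank ℝ γ < Module.finrank ℝ V := by
      have h1 := Submodule.finrank_add_le_finrank_add_finrank (α ⊔ α.map J)
        (Submodule.span ℝ {z})
      have h2 := Submodule.finrank_add_le_finrank_add_finrank α (α.map J)
      have h3 := Submodule.finrank_map_le J α
      have h4 : Module.finrank ℝ (Submodule.span ℝ {z}) ≤ 1 := by
        have := finrank_span_finset_le_card (R := ℝ) ({z} : Finset V)
        rwa [Finset.coe_singleton, Finset.card_singleton] at this
      change Module.finrank ℝ ↥(α ⊔ α.map J ⊔ Submodule.span ℝ {z}) < _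
      omega
    have hne : γᗮ ≠ ⊥ := fun h ↦ by
      rw [Submodule.orthogonal_eq_bot_iff] at h
      rw [h, finrank_top] at hγ
      exact lt_irrefl _ hγ
    obtain ⟨w, hw, hw0⟩ := Submodule.exists_mem_ne_zero_of_ne_bot hne
    have w1 (x : V) (hx : x ∈ α) : ⟪x, w⟫_ℝ = 0 :=
      hw x (Submodule.mem_sup_left (Submodule.mem_sup_left hx))
    have w2 (x : V) (hx : x ∈ α) : ⟪J x, w⟫_ℝ = 0 :=
      hw _ (Submodule.mem_sup_left (Submodule.mem_sup_right (Submodule.mem_map_of_mem hx)))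
    have w3 : ⟪z, w⟫_ℝ = 0 :=
      hw z (Submodule.mem_sup_right (Submodule.mem_span_singleton_self z))
    have hinf : α ⊓ Submodule.span ℝ {w} = ⊥ := by
      rw [Submodule.eq_bot_iff]
      rintro v ⟨hv, hv'⟩
      obtain ⟨t, rfl⟩ := Submodule.mem_span_singleton.1 hv'
      have := w1 _ hv
      rw [real_inner_smul_left] at this
      rw [(mul_eq_zero.1 this).resolve_right (inner_self_ne_zero.2 hw0), zero_smul]
    have hrank := Submodule.finrank_sup_add_finrank_inf_eq α (Submodule.span ℝ {w})
    rw [hinf, finrank_bot, finrank_span_singleton hw0] at hrank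
    have hreal : IsTotallyReal J (α ⊔ Submodule.span ℝ {w}) := by
      intro u hu v hv
      obtain ⟨x, hx, _, hx', rfl⟩ := Submodule.mem_sup.1 hu
      obtain ⟨y, hy, _, hy', rfl⟩ := Submodule.mem_sup.1 hv
      obtain ⟨s, rfl⟩ := Submodule.mem_span_singleton.1 hx'
      obtain ⟨t, rfl⟩ := Submodule.mem_span_singleton.1 hy'
      have h3 : ⟪J w, y⟫_ℝ = 0 := by
        rw [hJ.inner_left, real_inner_comm, w2 y hy, neg_zero]
      have h4 : ⟪J w, w⟫_ℝ = 0 := by rw [hJ.inner_left, hJ.inner_self, neg_zero]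
      simp only [map_add, map_smul, inner_add_left, inner_add_right, real_inner_smul_left,
        real_inner_smul_right, hα x hx y hy, w2 x hx, h3, h4]
      ring
    have horth : ∀ x ∈ α ⊔ Submodule.span ℝ {w}, ⟪x, z⟫_ℝ = 0 := by
      intro u hu
      obtain ⟨x, hx, _, hx', rfl⟩ := Submodule.mem_sup.1 hu
      obtain ⟨s, rfl⟩ := Submodule.mem_span_singleton.1 hx'
      rw [inner_add_left, hz x hx, real_inner_smul_left, real_inner_comm, w3]
      ring
    obtain ⟨β, h1, h2⟩ := ih _ hreal horth (by omega)
    exact ⟨β, le_sup_left.trans h1, h2⟩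

include hJ in
theorem HermitianOrthogonal.isTotallyReal_span {x y : V} (h : HermitianOrthogonal J x y) :
    IsTotallyReal J (Submodule.span ℝ {x, y}) := by
  intro u hu v hv
  obtain ⟨a, b, rfl⟩ := Submodule.mem_span_pair.1 hu
  obtain ⟨c, d, rfl⟩ := Submodule.mem_span_pair.1 hv
  simp only [map_add, map_smul, inner_add_left, inner_add_right, real_inner_smul_left,
    real_inner_smul_right, hJ.inner_left, hJ.inner_self, h.2, (h.symm hJ).2]
  ring

include hJ in
/-- If the antiholomorphic subspaces of dimension `n` are curvature invariant, then `R(x, y)y` is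
orthogonal to every `z` orthogonal to `x` and `y`, because `x` and `y` lie in such a subspace
orthogonal to `z`. -/
theorem isAntiholomorphicFlat_of_invariant [FiniteDimensional ℝ V] {m n : ℕ} (hn : 2 ≤ n)
    (hnm : n ≤ m) (hV : Module.finrank ℝ V = 2 * m) (R : V → V → V → V)
    (hR : ∀ α : Submodule ℝ V, Module.finrank ℝ α = n → IsTotallyReal J α →
      ∀ x ∈ α, ∀ y ∈ α, ∀ z ∈ α, R x y z ∈ α) :
    IsAntiholomorphicFlat J fun x y z u ↦ ⟪R x y z, u⟫_ℝ := by
  intro x y z hxy hxz hyz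
  have hrank : Module.finrank ℝ (Submodule.span ℝ {x, y}) ≤ 2 := by
    classical
    have := finrank_span_finset_le_card (R := ℝ) ({x, y} : Finset V)
    simp only [Finset.coe_insert, Finset.coe_singleton] at this
    exact this.trans Finset.card_le_two
  obtain ⟨β, h1, h2, h3, h4⟩ := (hxy.isTotallyReal_span hJ).exists_extension hJ hnm hV z
    (k := n - Module.finrank ℝ (Submodule.span ℝ {x, y})) _ (by
      intro v hv
      obtain ⟨a, b, rfl⟩ := Submodule.mem_span_pair.1 hv
      rw [inner_add_left, real_inner_smul_left, real_inner_smul_left, hxz, hyz]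
      ring) (by omega)
  have hx := h1 (Submodule.subset_span (show x ∈ ({x, y} : Set V) by simp))
  have hy := h1 (Submodule.subset_span (show y ∈ ({x, y} : Set V) by simp))
  exact h3 _ (hR β h4 h2 x hx y hy y hy)

end Algebra

/-! ### Invariance of the model and orthonormal pairs -/

section

variable {V : Type*} [NormedAddCommGroup V] [InnerProductSpace ℝ V] {J : V →ₗ[ℝ] V}

theorem modelR₂_invariant (hJ : IsOrthogonalComplex J) (x y z u : V) :
    modelR₂ J (J x) (J y) (J z) (J u) = modelR₂ J x y z u := by
  simp only [modelR₂, hJ.inner_apply_apply]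

theorem modelR₁_invariant (hJ : IsOrthogonalComplex J) (x y z u : V) :
    modelR₁ (J x) (J y) (J z) (J u) = modelR₁ x y z u := by
  simp only [modelR₁, hJ.inner_apply_apply]

theorem orthonormal_pair {x y : V} (h : Orthonormal ℝ ![x, y]) :
    ⟪x, x⟫_ℝ = 1 ∧ ⟪y, y⟫_ℝ = 1 ∧ ⟪x, y⟫_ℝ = 0 := by
  refine ⟨?_, ?_, by simpa using h.2 (i := 0) (j := 1) (by simp)⟩
  · rw [real_inner_self_eq_norm_sq, show ‖x‖ = 1 from h.1 0, one_pow]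
  · rw [real_inner_self_eq_norm_sq, show ‖y‖ = 1 from h.1 1, one_pow]

/-- In a holomorphic plane with orthonormal basis `x`, `y`, the vector `J y` is `x` or `-x`. -/
theorem inner_sq_of_map_span_le (hJ : IsOrthogonalComplex J) {x y : V}
    (h : Orthonormal ℝ ![x, y])
    (hxy : (Submodule.span ℝ {x, y}).map J ≤ Submodule.span ℝ {x, y}) : ⟪x, J y⟫_ℝ ^ 2 = 1 := by
  obtain ⟨hx, hy, h0⟩ := orthonormal_pair h
  obtain ⟨a, b, hab⟩ := Submodule.mem_span_pair.1
    (hxy (Submodule.mem_map_of_mem (Submodule.subset_span (show y ∈ ({x, y} : Set V) by simp))))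
  have hb : b = 0 := by
    have := hJ.inner_self y
    rwa [← hab, inner_add_right, real_inner_smul_right, real_inner_smul_right, real_inner_comm,
      h0, hy, mul_zero, zero_add, mul_one] at this
  subst hb
  have := hJ.inner_apply_apply y y
  rw [← hab, zero_smul, add_zero, real_inner_smul_left, real_inner_smul_right, hx, hy] at this
  rw [← hab, zero_smul, add_zero, real_inner_smul_right, hx]
  linarith

end

end AlmostHermitian

end

theorem theorem2 {m : ℕ} (hm : 2 ≤ m)
    {M : Type*} [TopologicalSpace M] [ChartedSpace (EuclideanSpace ℝ (Fin (2 * m))) M]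
    [IsManifold (𝓡 (2 * m)) ∞ M]
    [RiemannianBundle (fun x : M ↦ TangentSpace (𝓡 (2 * m)) x)]
    [IsContMDiffRiemannianBundle (𝓡 (2 * m)) ∞ (EuclideanSpace ℝ (Fin (2 * m)))
      (fun x : M ↦ TangentSpace (𝓡 (2 * m)) x)]
    (S : AlmostHermitian.AlmostHermitianStructure (EuclideanSpace ℝ (Fin (2 * m))) M)
    {n : ℕ} (hn : 2 ≤ n) (hnm : n ≤ m)
    (hax : S.AxiomOfAntiholomorphicPlanes n ∨ S.AxiomOfAntiholomorphicSpheres n) :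
    S.IsRK ∧ ∃ c K : M → ℝ, S.HasHolomorphicCurvature c ∧ S.HasAntiholomorphicCurvature K ∧
      ∀ (p : M) (x y z u : TangentSpace (𝓡 (2 * m)) p),
        AlmostHermitian.curvature₄ p x y z u
          = K p * AlmostHermitian.R₁ p x y z u
            + (c p - K p) * S.R₂ p x y z u / 3 := by
  have hJ (p : M) : AlmostHermitian.IsOrthogonalComplex (S.J p).toLinearMap :=
    ⟨S.J_J p, S.inner_J_J p⟩
  have hV (p : M) : Module.finrank ℝ (TangentSpace (𝓡 (2 * m)) p) = 2 * m :=
    finrank_euclideanSpace_fin (𝕜 := ℝ) (n := 2 * m)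
  have hmodel (p : M) := (AlmostHermitian.isCurvatureLike_curvature₄ p).exists_eq_model (hJ p)
    (AlmostHermitian.isAntiholomorphicFlat_of_invariant (hJ p) hn hnm (hV p)
      (AlmostHermitian.curvature p) fun α h1 h2 x hx y hy z hz ↦
        AlmostHermitian.curvature_mem_of_axiom hax h1 h2 hx hy hz) (by rw [hV]; omega)
  choose c K h using hmodel
  refine ⟨fun p x y z u ↦ ?_, c, K, fun p x y hxy hα ↦ ?_, fun p x y hxy hα ↦ ?_,
    fun p x y z u ↦ ?_⟩
  · rw [h, h]
    exact congrArg₂ (K p * · + (c p - K p) / 3 * ·)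
      (AlmostHermitian.modelR₁_invariant (hJ p) x y z u).symm
      (AlmostHermitian.modelR₂_invariant (hJ p) x y z u).symm
  · have h1 := AlmostHermitian.inner_sq_of_map_span_le (hJ p) hxy hα.le
    obtain ⟨hx, hy, h0⟩ := AlmostHermitian.orthonormal_pair hxy
    rw [h, AlmostHermitian.modelR₁, AlmostHermitian.modelR₂, hx, hy, h0, (hJ p).inner_self,
      (hJ p).inner_right y x]
    linear_combination (c p - K p) * h1
  · have h1 := hα x (Submodule.subset_span (by simp)) y (Submodule.subset_span (by simp))
    obtain ⟨hx, hy, h0⟩ := AlmostHermitian.orthonormal_pair hxy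
    have h2 : ⟪x, (S.J p).toLinearMap y⟫_ℝ = 0 := by
      rw [← neg_eq_zero, ← (hJ p).inner_left]
      exact h1
    rw [h, AlmostHermitian.modelR₁, AlmostHermitian.modelR₂, hx, hy, h0, (hJ p).inner_self, h2]
    ring
  · rw [h, mul_div_right_comm]
    rfl
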